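/- Let $a>b>0$, $p^2=a^2+b^2$, $r^2=a^2-b^2$. On $\mathbb R^9$ with coordinates $\alpha,\beta,\omega\in\mathbb R^3$ let $\mathcal P$ be the set where $|\alpha|=a$, $|\beta|=b$, $\alpha\cdot\beta=0$, and put ($\mathrm i^2=-1$) $$x_{1,2}=(\alpha_1-\beta_2)\pm\mathrm i(\alpha_2+\beta_1),\quad y_{1,2}=(\alpha_1+\beta_2)\pm\mathrm i(\alpha_2-\beta_1),\quad z_{1,2}=\alpha_3\pm\mathrm i\beta_3,\quad w_{1,2}=\omega_1\pm\mathrm i\omega_2,\quad w_3=\omega_3$$ (upper sign for index 1). The third critical subsystem $\mathfrak O\subset\mathcal P$ of the Kowalevski top in two constant fields is the set of points of $\mathcal P$ with $w_1\ne0$, $w_2\neq 0$ at which $$\frac{w_2x_1+w_1y_2+w_3z_1}{w_1}-\frac{w_1x_2+w_2y_1+w_3z_2}{w_2}=0,$$ $$(w_2z_1+w_1z_2)w_3^2+\Bigl[\frac{w_2z_1^2}{w_1}+\frac{w_1z_2^2}{w_2}+w_1w_2(y_1+y_2)+x_1w_2^2+x_2w_1^2\Bigr]w_3+\frac{w_2^2x_1z_1}{w_1}+\frac{w_1^2x_2z_2}{w_2}+x_1z_2w_2+x_2z_1w_1+(w_1z_2-w_2z_1)(y_1-y_2)=0.$$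 The integral map $S\times\mathrm T:\mathfrak O\to\mathbb R^2$ is given by the (real-valued) functions $$S=-\frac14\Bigl(\frac{y_2w_1+x_1w_2+z_1w_3}{w_1}+\frac{x_2w_1+y_1w_2+z_2w_3}{w_2}\Bigr),$$ $$\mathrm T=\frac12\bigl[w_1(x_2w_1+y_1w_2+z_2w_3)+w_2(y_2w_1+x_1w_2+z_1w_3)\bigr]+x_1x_2+z_1z_2 .$$ Let $\theta(\tau)=\frac12\sqrt{2p^2-\frac{\tau^2+r^4}{\tau}}$, and let $D$ be the set of points $(s,\tau)\in\mathbb R^2$ with $s\neq0$ that satisfy one of the following: $$\begin{array}{ll} 0<s\le a, & \tau\le -r^2;\\ 0<s\le\theta(\tau), & -r^2\le\tau<0;\\ 0<s<+\infty, & 0\le\tau<(a-b)^2;\\ -a\le s\le -b\ \text{ or }\ \theta(\tau)\le s<+\infty, & (a-b)^2\le\tau\le r^2;\\ -a\le s\le-\theta(\tau)\ \text{ or }\ b\le s<+\infty, & r^2\le\tau\le(a+b)^2;\\ -a\le s<0, & \tau>(a+b)^2. \end{array}$$ Theorem. (1) The image of $S\times \mathrm T$, extended by continuity to the limit points of $\mathfrak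 O$, is $D$. That is, $(s,\tau)\in D$ if and only if there is a sequence in $\mathfrak O$ that converges in $\mathcal P$ and along which $(S,\mathrm T)\to(s,\tau)$. (2) The set of values that $S\times\mathrm T$ takes at the points of $\mathfrak O$ itself is $D$ without the boundary pieces $\{\tau=(a-b)^2,\ s<0\}$ and $\{\tau=(a+b)^2,\ s>0\}$. -/

import Mathlib

/-! The third critical subsystem of the Kowalevski top in two constant fields. -/

noncomputable section

namespace KowalevskiTop

open Complex

/-- The space `ℝ⁹` of triples `(α, β, ω)`: the two field intensities and the angular velocity, in
the moving frame. The component with index `i` of the mathematics has index `i - 1` here. -/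
abbrev State : Type := (Fin 3 → ℝ) × (Fin 3 → ℝ) × (Fin 3 → ℝ)

/-- First field intensity. -/
def fieldA (q : State) : Fin 3 → ℝ := q.1

/-- Second field intensity. -/
def fieldB (q : State) : Fin 3 → ℝ := q.2.1

/-- Angular velocity. -/
def omega (q : State) : Fin 3 → ℝ := q.2.2

/-- The six-dimensional phase space: `|α| = a`, `|β| = b`, `α · β = 0`. -/
def phaseSpace (a b : ℝ) : Set State :=
  {q | fieldA q ⬝ᵥ fieldA q = a ^ 2 ∧ fieldB q ⬝ᵥ fieldB q = b ^ 2 ∧ fieldA q ⬝ᵥ fieldB q = 0}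

/-! The complex phase variables. -/

def x₁ (q : State) : ℂ :=
  ((fieldA q 0 - fieldB q 1 : ℝ) : ℂ) + I * ((fieldA q 1 + fieldB q 0 : ℝ) : ℂ)

def x₂ (q : State) : ℂ :=
  ((fieldA q 0 - fieldB q 1 : ℝ) : ℂ) - I * ((fieldA q 1 + fieldB q 0 : ℝ) : ℂ)

def y₁ (q : State) : ℂ :=
  ((fieldA q 0 + fieldB q 1 : ℝ) : ℂ) + I * ((fieldA q 1 - fieldB q 0 : ℝ) : ℂ)

def y₂ (q : State) : ℂ :=
  ((fieldA q 0 + fieldB q 1 : ℝ) : ℂ) - I * ((fieldA q 1 - fieldB q 0 : ℝ) : ℂ)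

def z₁ (q : State) : ℂ := (fieldA q 2 : ℂ) + I * (fieldB q 2 : ℂ)

def z₂ (q : State) : ℂ := (fieldA q 2 : ℂ) - I * (fieldB q 2 : ℂ)

def w₁ (q : State) : ℂ := (omega q 0 : ℂ) + I * (omega q 1 : ℂ)

def w₂ (q : State) : ℂ := (omega q 0 : ℂ) - I * (omega q 1 : ℂ)

def w₃ (q : State) : ℂ := (omega q 2 : ℂ)

/-- Left-hand side of the first equation of the third critical subsystem. -/
def firstRelation (q : State) : ℂ :=
  (w₂ q * x₁ q + w₁ q * y₂ q + w₃ q * z₁ q) / w₁ q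
    - (w₁ q * x₂ q + w₂ q * y₁ q + w₃ q * z₂ q) / w₂ q

/-- Left-hand side of the second equation of the third critical subsystem. -/
def secondRelation (q : State) : ℂ :=
  (w₂ q * z₁ q + w₁ q * z₂ q) * w₃ q ^ 2
    + (w₂ q * z₁ q ^ 2 / w₁ q + w₁ q * z₂ q ^ 2 / w₂ q + w₁ q * w₂ q * (y₁ q + y₂ q)
        + x₁ q * w₂ q ^ 2 + x₂ q * w₁ q ^ 2) * w₃ q
    + w₂ q ^ 2 * x₁ q * z₁ q / w₁ q + w₁ q ^ 2 * x₂ q * z₂ q / w₂ q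
    + x₁ q * z₂ q * w₂ q + x₂ q * z₁ q * w₁ q
    + (w₁ q * z₂ q - w₂ q * z₁ q) * (y₁ q - y₂ q)

/-- The third critical subsystem. The denominators `w₁`, `w₂` in its equations (and in the first
integral `S`) are required not to vanish. -/
def thirdSystem (a b : ℝ) : Set State :=
  {q | q ∈ phaseSpace a b ∧ w₁ q ≠ 0 ∧ w₂ q ≠ 0 ∧ firstRelation q = 0 ∧ secondRelation q = 0}

/-- The complex expression of the first integral `S`; its value is real, see `S_coe`. -/
def complexS (q : State) : ℂ :=
  -(1 / 4) * ((y₂ q * w₁ q + x₁ q * w₂ q + z₁ q * w₃ q) / w₁ q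
    + (x₂ q * w₁ q + y₁ q * w₂ q + z₂ q * w₃ q) / w₂ q)

/-- The complex expression of the first integral `T`; its value is real, see `T_coe`. -/
def complexT (q : State) : ℂ :=
  (1 / 2) * (w₁ q * (x₂ q * w₁ q + y₁ q * w₂ q + z₂ q * w₃ q)
      + w₂ q * (y₂ q * w₁ q + x₁ q * w₂ q + z₁ q * w₃ q))
    + x₁ q * x₂ q + z₁ q * z₂ q

def S (q : State) : ℝ := (complexS q).re

def T (q : State) : ℝ := (complexT q).re

theorem S_coe (q : State) : ((S q : ℝ) : ℂ) = complexS q := by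
  apply conj_eq_iff_re.mp
  simp only [complexS, x₁, x₂, y₁, y₂, z₁, z₂, w₁, w₂, w₃, map_mul, map_add, map_sub, map_neg,
    map_div₀, map_one, map_ofNat, conj_ofReal, conj_I]
  ring

theorem T_coe (q : State) : ((T q : ℝ) : ℂ) = complexT q := by
  apply conj_eq_iff_re.mp
  simp only [complexT, x₁, x₂, y₁, y₂, z₁, z₂, w₁, w₂, w₃, map_mul, map_add, map_sub,
    map_div₀, map_one, map_ofNat, conj_ofReal, conj_I]
  ring

/-- The integral map `S × T`. -/
def integralMap (q : State) : ℝ × ℝ := (S q, T q)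

/-- All pairs `(s, τ)` for which there are a point `q` of the phase space and points of the third
subsystem converging to `q` along which `(S, T)` converges to `(s, τ)`: the image of the integral
map extended (as a possibly many-valued map) by continuity to the limit points of its domain. -/
def extendedImage (a b : ℝ) : Set (ℝ × ℝ) :=
  Prod.snd '' closure ((fun q : State => (q, integralMap q)) '' thirdSystem a b)

/-- `θ(τ) = ½ √(2p² - (τ² + r⁴)/τ)` with `p² = a² + b²`, `r² = a² - b²`. -/
def theta (a b τ : ℝ) : ℝ :=
  1 / 2 * Real.sqrt (2 * (a ^ 2 + b ^ 2) - (τ ^ 2 + (a ^ 2 - b ^ 2) ^ 2) / τ)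

/-- The admissible region in the plane of `(s, τ)`. -/
def admissibleRegion (a b : ℝ) : Set (ℝ × ℝ) :=
  {f | f.1 ≠ 0 ∧
    ((f.2 ≤ -(a ^ 2 - b ^ 2) ∧ 0 < f.1 ∧ f.1 ≤ a) ∨
     (-(a ^ 2 - b ^ 2) ≤ f.2 ∧ f.2 < 0 ∧ 0 < f.1 ∧ f.1 ≤ theta a b f.2) ∨
     (0 ≤ f.2 ∧ f.2 < (a - b) ^ 2 ∧ 0 < f.1) ∨
     ((a - b) ^ 2 ≤ f.2 ∧ f.2 ≤ a ^ 2 - b ^ 2 ∧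
        ((-a ≤ f.1 ∧ f.1 ≤ -b) ∨ theta a b f.2 ≤ f.1)) ∨
     (a ^ 2 - b ^ 2 ≤ f.2 ∧ f.2 ≤ (a + b) ^ 2 ∧
        ((-a ≤ f.1 ∧ f.1 ≤ -theta a b f.2) ∨ b ≤ f.1)) ∨
     ((a + b) ^ 2 < f.2 ∧ -a ≤ f.1 ∧ f.1 < 0))}

end KowalevskiTop

end

namespace KowalevskiTop

/-! Write `x, y, z, w` for `x₁, y₁, z₁, w₁`, `h` for `ω₃`, `U = |x|² + |z|²`, `E = U - τ`, `r² = a²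
- b²`, `D = discr a b s τ`.

On the subsystem the equations become `Solves`: the first critical equation says that the two
summands of `S` agree, and the second, modulo the first, factors through one short complex equation
(`secondRelation_mul_eq`). Since `E = 2s|w|²`, the angular velocity can be eliminated: `|y + 2s|² =
|x|² + 2s h²` (`Solves.normSq_add`) and `|x z̄ - (y + 2s) z|² = 4s² h² |w|²` give `E (|y + 2s|² -
|x|²) = |x z̄ - (y + 2s) z|²`. By `elimination_identity` this prescribes the value `Q` of `Re (r² x
- τ y)`. A common rotation of `x` and `y` preserves the phase space, so the only obstruction is `Q²
≤ |r² x - τ y|²`, and the right side depends only on `|x|` and `U` (`normSq_combination`). The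
inequality factors as `((E - 2s|x|)² - D) ((E + 2s|x|)² - D) ≤ 0`; as `sE > 0`, it means that `D`
lies between the two squares. This is `AttainedAt`.

The points `(|x|, U)` of the phase space fill a triangle with vertices `(0, r²)`, `(a - b, (a -
b)²)`, `(a + b, (a + b)²)`. What remains is a plane problem: for which `(s, τ)` does the triangle
meet the set above? The forms `E ± 2s|x| ± √D` are affine in `(|x|, U)`, so their signs at the
vertices decide, and the differences of squares factor there. Vertex signs exclude pairs outside the
region, except for one case of `s < -a` that uses an edge; inside it a vertex or a point on an edge
serves.

On the triangle `(a - b)² ≤ U ≤ (a + b)²`, so the strict inequality `sE > 0` removes exactly the two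
boundary pieces of part (2). They return as limits: for fixed `s ≠ 0` the angular velocity stays
bounded as `τ` approaches them. No limit has `s = 0`, because the relations surviving there
contradict the phase space (`not_degenerate_of_constraints`). -/

/-- The discriminant whose sign bounds the admissible region. -/
def discr (a b s τ : ℝ) : ℝ :=
  τ ^ 2 - 2 * (a ^ 2 + b ^ 2) * τ + (a ^ 2 - b ^ 2) ^ 2 + 4 * s ^ 2 * τ

/-- The triangle filled by the points `(|x₁|, |x₁|² + |z₁|²)` of the phase space. -/
def InTriangle (a b x U : ℝ) : Prop :=
  U - (a ^ 2 - b ^ 2) ≤ 2 * b * x ∧ (a ^ 2 - b ^ 2) - U ≤ 2 * b * x ∧ 2 * a * x ≤ U + (a ^ 2 - b ^ 2)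

/-- The closure conditions of the admissible region, free of square roots. -/
def Admissible (a b s τ : ℝ) : Prop :=
  (0 ≤ s ∧ τ ≤ (a + b) ^ 2 ∧ 0 ≤ discr a b s τ ∧ (s ≤ a ∨ -(a ^ 2 - b ^ 2) ≤ τ) ∧
    (b ≤ s ∨ τ ≤ a ^ 2 - b ^ 2)) ∨
  (s ≤ 0 ∧ (a - b) ^ 2 ≤ τ ∧ 0 ≤ discr a b s τ ∧ -a ≤ s ∧ (s ≤ -b ∨ a ^ 2 - b ^ 2 ≤ τ))

/-- A pair `(s, τ)` is attained at a point of the triangle with coordinates `(x, U)`. -/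
def AttainedAt (a b s τ x U : ℝ) : Prop :=
  InTriangle a b x U ∧ 0 < s * (U - τ) ∧
    (U - τ - 2 * s * x) ^ 2 ≤ discr a b s τ ∧ discr a b s τ ≤ (U - τ + 2 * s * x) ^ 2

/-! ### The region without square roots. -/

section Plane

variable {a b s τ x U : ℝ}

/-- Equivalently `discr a b s τ = 4τ (s² - θ²)`, so comparing `|s|` with `θ` amounts to the sign of
`discr`, with the direction reversed when `τ < 0`. -/
theorem four_theta_sq (hτ : τ ≠ 0)
    (h : 0 ≤ 2 * (a ^ 2 + b ^ 2) - (τ ^ 2 + (a ^ 2 - b ^ 2) ^ 2) / τ) :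
    4 * τ * theta a b τ ^ 2 = 2 * (a ^ 2 + b ^ 2) * τ - τ ^ 2 - (a ^ 2 - b ^ 2) ^ 2 := by
  rw [theta, mul_pow, Real.sq_sqrt h]
  field_simp
  ring

theorem theta_nonneg : 0 ≤ theta a b τ := by
  unfold theta; positivity

theorem theta_radicand_nonneg_of_neg (hτ : τ < 0) :
    0 ≤ 2 * (a ^ 2 + b ^ 2) - (τ ^ 2 + (a ^ 2 - b ^ 2) ^ 2) / τ := by
  have : (τ ^ 2 + (a ^ 2 - b ^ 2) ^ 2) / τ ≤ 0 := div_nonpos_of_nonneg_of_nonpos (by positivity) hτ.le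
  nlinarith [sq_nonneg a, sq_nonneg b]

theorem theta_radicand_nonneg (hab : b < a) (h₁ : (a - b) ^ 2 ≤ τ)
    (h₂ : τ ≤ (a + b) ^ 2) :
    0 ≤ 2 * (a ^ 2 + b ^ 2) - (τ ^ 2 + (a ^ 2 - b ^ 2) ^ 2) / τ := by
  have hτ : 0 < τ := lt_of_lt_of_le (by have := sub_pos.2 hab; positivity) h₁
  rw [sub_nonneg, div_le_iff₀ hτ]
  nlinarith [mul_nonneg (sub_nonneg.2 h₁) (sub_nonneg.2 h₂)]

theorem le_theta_iff_of_neg (hτ : τ < 0) (hs : 0 ≤ s) : s ≤ theta a b τ ↔ 0 ≤ discr a b s τ := by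
  have h := four_theta_sq hτ.ne (theta_radicand_nonneg_of_neg (a := a) (b := b) hτ)
  rw [← sq_le_sq₀ hs theta_nonneg, discr]
  constructor <;> intro h' <;> nlinarith

theorem theta_le_iff (hab : b < a) (h₁ : (a - b) ^ 2 ≤ τ) (h₂ : τ ≤ (a + b) ^ 2)
    (hs : 0 ≤ s) : theta a b τ ≤ s ↔ 0 ≤ discr a b s τ := by
  have hτ : 0 < τ := lt_of_lt_of_le (by have := sub_pos.2 hab; positivity) h₁
  have h := four_theta_sq hτ.ne' (theta_radicand_nonneg hab h₁ h₂)
  rw [← sq_le_sq₀ theta_nonneg hs, discr]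
  constructor <;> intro h' <;> nlinarith

theorem discr_neg_left : discr a b (-s) τ = discr a b s τ := by
  simp [discr]

/-- On `s² = a²` the discriminant is the square `(τ + r²)²`; likewise it is `(τ - r²)²` on `s² =
b²`. The curve `discr = 0` therefore touches these lines at `τ = ∓r²`, where the description of the
region changes. -/
theorem discr_nonneg_of_sq_le (hs : s ^ 2 ≤ a ^ 2) (hτ : τ ≤ 0) : 0 ≤ discr a b s τ := by
  unfold discr
  nlinarith [mul_nonneg (sub_nonneg.2 hs) (neg_nonneg.2 hτ), sq_nonneg (τ + (a ^ 2 - b ^ 2))]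

theorem discr_nonneg_of_le_sq (hs : b ^ 2 ≤ s ^ 2) (hτ : 0 ≤ τ) : 0 ≤ discr a b s τ := by
  unfold discr
  nlinarith [mul_nonneg (sub_nonneg.2 hs) hτ, sq_nonneg (τ - (a ^ 2 - b ^ 2))]

theorem discr_nonneg_of_le (hb : 0 < b) (hab : b < a) (h₀ : 0 ≤ τ) (h₁ : τ ≤ (a - b) ^ 2) :
    0 ≤ discr a b s τ := by
  have h₂ : τ ≤ (a + b) ^ 2 := by nlinarith
  have : discr a b s τ = ((a - b) ^ 2 - τ) * ((a + b) ^ 2 - τ) + 4 * (s ^ 2 * τ) := by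
    unfold discr; ring
  rw [this]
  have := mul_nonneg (sub_nonneg.2 h₁) (sub_nonneg.2 h₂)
  positivity

theorem discr_nonneg_of_ge (hb : 0 < b) (hab : b < a) (h₁ : (a + b) ^ 2 ≤ τ) :
    0 ≤ discr a b s τ := by
  have h₂ : (a - b) ^ 2 ≤ τ := by nlinarith
  have h₀ : 0 ≤ τ := le_trans (sq_nonneg _) h₂
  have : discr a b s τ = (τ - (a - b) ^ 2) * (τ - (a + b) ^ 2) + 4 * (s ^ 2 * τ) := by
    unfold discr; ring
  rw [this]
  have := mul_nonneg (sub_nonneg.2 h₂) (sub_nonneg.2 h₁)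
  positivity

theorem mem_admissibleRegion_iff (hb : 0 < b) (hab : b < a) :
    (s, τ) ∈ admissibleRegion a b ↔ s ≠ 0 ∧ Admissible a b s τ := by
  have ha : 0 < a := hb.trans hab
  have hr : 0 < a ^ 2 - b ^ 2 := by nlinarith
  have hm : (a - b) ^ 2 < a ^ 2 - b ^ 2 := by nlinarith
  have hp : a ^ 2 - b ^ 2 < (a + b) ^ 2 := by nlinarith
  have hm0 : 0 < (a - b) ^ 2 := by have := sub_pos.2 hab; positivity
  simp only [admissibleRegion, Set.mem_ofPred_eq, Admissible]
  refine and_congr_right fun hs => ?_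
  constructor
  · rintro (⟨h1, h2, h3⟩ | ⟨h1, h2, h3, h4⟩ | ⟨h1, h2, h3⟩ | ⟨h1, h2, ⟨h3, h4⟩ | h3⟩ |
      ⟨h1, h2, ⟨h3, h4⟩ | h3⟩ | ⟨h1, h2, h3⟩)
    · exact .inl ⟨h2.le, by linarith, discr_nonneg_of_sq_le (by gcongr) (by linarith), .inl h3,
        .inr (by linarith)⟩
    · exact .inl ⟨h3.le, by linarith, (le_theta_iff_of_neg h2 h3.le).1 h4, .inr h1,
        .inr (by linarith)⟩
    · exact .inl ⟨h3.le, by linarith, discr_nonneg_of_le hb hab h1 h2.le, .inr (by linarith),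
        .inr (by linarith)⟩
    · exact .inr ⟨by linarith, h1, discr_nonneg_of_le_sq (by nlinarith) (by linarith), h3, .inl h4⟩
    · have h0 : 0 ≤ s := theta_nonneg.trans h3
      exact .inl ⟨h0, by linarith, (theta_le_iff hab h1 (by linarith) h0).1 h3,
        .inr (by linarith), .inr h2⟩
    · have h0 : 0 ≤ -s := theta_nonneg.trans (by linarith : theta a b τ ≤ -s)
      refine .inr ⟨by linarith, by linarith, ?_, h3, .inr h1⟩
      rw [← discr_neg_left]
      exact (theta_le_iff hab (by linarith) h2 h0).1 (by linarith)
    · exact .inl ⟨by linarith, h2, discr_nonneg_of_le_sq (by gcongr) (by linarith),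
        .inr (by linarith), .inl h3⟩
    · exact .inr ⟨h3.le, by linarith, discr_nonneg_of_ge hb hab h1.le, h2, .inr (by linarith)⟩
  · rintro (⟨h1, h2, h3, h4, h5⟩ | ⟨h1, h2, h3, h4, h5⟩)
    · have h0 : 0 < s := lt_of_le_of_ne h1 hs.symm
      rcases lt_or_ge τ (-(a ^ 2 - b ^ 2)) with k1 | k1
      · exact .inl ⟨k1.le, h0, h4.resolve_right (by linarith)⟩
      rcases lt_or_ge τ 0 with k2 | k2
      · exact .inr (.inl ⟨k1, k2, h0, (le_theta_iff_of_neg k2 h1).2 h3⟩)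
      rcases lt_or_ge τ ((a - b) ^ 2) with k3 | k3
      · exact .inr (.inr (.inl ⟨k2, k3, h0⟩))
      rcases le_or_gt τ (a ^ 2 - b ^ 2) with k4 | k4
      · exact .inr (.inr (.inr (.inl ⟨k3, k4, .inr
          ((theta_le_iff hab k3 (by linarith) h1).2 h3)⟩)))
      · exact .inr (.inr (.inr (.inr (.inl ⟨k4.le, h2, .inr (h5.resolve_right (by linarith))⟩))))
    · have h0 : s < 0 := lt_of_le_of_ne h1 hs
      rcases lt_or_ge τ (a ^ 2 - b ^ 2) with k1 | k1
      · exact .inr (.inr (.inr (.inl ⟨h2, k1.le, .inl ⟨h4, h5.resolve_right (by linarith)⟩⟩)))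
      rcases le_or_gt τ ((a + b) ^ 2) with k2 | k2
      · refine .inr (.inr (.inr (.inr (.inl ⟨k1, k2, .inl ⟨h4, ?_⟩⟩))))
        rw [← discr_neg_left] at h3
        linarith [(theta_le_iff hab h2 k2 (by linarith : 0 ≤ -s)).2 h3]
      · exact .inr (.inr (.inr (.inr (.inr ⟨k2, h4, h0⟩))))

/-! ### Affine forms on the triangle and their vertex values. -/

theorem InTriangle.affine_neg (hb : 0 < b) (hab : b < a) (h : InTriangle a b x U) {A B C : ℝ}
    (h₀ : B * (a ^ 2 - b ^ 2) + C < 0) (h₁ : A * (a - b) + B * (a - b) ^ 2 + C < 0)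
    (h₂ : A * (a + b) + B * (a + b) ^ 2 + C < 0) : A * x + B * U + C < 0 := by
  obtain ⟨k1, k2, k3⟩ := h
  have hm : 0 < a - b := sub_pos.2 hab
  have hp : 0 < a + b := by linarith
  have hr : 0 < (a - b) * (a + b) := mul_pos hm hp
  -- The three coefficients are the barycentric coordinates of `(x, U)` multiplied by `4b(a² - b²)`:
  -- each is the slack of the edge opposite its vertex.
  have key : 4 * b * ((a - b) * (a + b)) * (A * x + B * U + C) =
      2 * b * (U + (a ^ 2 - b ^ 2) - 2 * a * x) * (B * (a ^ 2 - b ^ 2) + C) +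
      (a + b) * ((a ^ 2 - b ^ 2) + 2 * b * x - U) * (A * (a - b) + B * (a - b) ^ 2 + C) +
      (a - b) * (U - (a ^ 2 - b ^ 2) + 2 * b * x) * (A * (a + b) + B * (a + b) ^ 2 + C) := by
    ring
  have l0 : 0 ≤ 2 * b * (U + (a ^ 2 - b ^ 2) - 2 * a * x) := mul_nonneg (by linarith) (by linarith)
  have l1 : 0 ≤ (a + b) * ((a ^ 2 - b ^ 2) + 2 * b * x - U) := mul_nonneg (by linarith) (by linarith)
  have l2 : 0 ≤ (a - b) * (U - (a ^ 2 - b ^ 2) + 2 * b * x) := mul_nonneg (by linarith) (by linarith)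
  by_contra! hc
  have e0 := mul_nonpos_of_nonneg_of_nonpos l0 h₀.le
  have e1 := mul_nonpos_of_nonneg_of_nonpos l1 h₁.le
  have e2 := mul_nonpos_of_nonneg_of_nonpos l2 h₂.le
  have e : 0 ≤ 4 * b * ((a - b) * (a + b)) * (A * x + B * U + C) := by positivity
  have z0 := (mul_eq_zero.1 (by linarith : 2 * b * (U + (a ^ 2 - b ^ 2) - 2 * a * x) *
    (B * (a ^ 2 - b ^ 2) + C) = 0)).resolve_right h₀.ne
  have z1 := (mul_eq_zero.1 (by linarith : (a + b) * ((a ^ 2 - b ^ 2) + 2 * b * x - U) *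
    (A * (a - b) + B * (a - b) ^ 2 + C) = 0)).resolve_right h₁.ne
  have z2 := (mul_eq_zero.1 (by linarith : (a - b) * (U - (a ^ 2 - b ^ 2) + 2 * b * x) *
    (A * (a + b) + B * (a + b) ^ 2 + C) = 0)).resolve_right h₂.ne
  have : 4 * b * ((a - b) * (a + b)) = 0 := by linear_combination z0 + z1 + z2
  have : 0 < 4 * b * ((a - b) * (a + b)) := by positivity
  linarith

theorem InTriangle.affine_pos (hb : 0 < b) (hab : b < a) (h : InTriangle a b x U) {A B C : ℝ}
    (h₀ : 0 < B * (a ^ 2 - b ^ 2) + C) (h₁ : 0 < A * (a - b) + B * (a - b) ^ 2 + C)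
    (h₂ : 0 < A * (a + b) + B * (a + b) ^ 2 + C) : 0 < A * x + B * U + C := by
  have := h.affine_neg hb hab (A := -A) (B := -B) (C := -C) (by linarith) (by linarith)
    (by linarith)
  linarith

theorem InTriangle.le_sq (hb : 0 < b) (hab : b < a) (h : InTriangle a b x U) : U ≤ (a + b) ^ 2 := by
  obtain ⟨k1, -, k3⟩ := h
  have := mul_le_mul_of_nonneg_left k1 (by linarith : 0 ≤ a)
  have := mul_le_mul_of_nonneg_left k3 hb.le
  nlinarith [sub_pos.2 hab]

theorem InTriangle.sq_le (hb : 0 < b) (hab : b < a) (h : InTriangle a b x U) : (a - b) ^ 2 ≤ U := by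
  obtain ⟨-, k2, k3⟩ := h
  have := mul_le_mul_of_nonneg_left k2 (by linarith : 0 ≤ a)
  have := mul_le_mul_of_nonneg_left k3 hb.le
  nlinarith [sub_pos.2 hab]

theorem InTriangle.nonneg (hb : 0 < b) (h : InTriangle a b x U) : 0 ≤ x := by
  obtain ⟨k1, k2, -⟩ := h
  nlinarith

/-! Values of the quadratic expressions at the vertices of the triangle. -/

theorem sq_sub_discr_upper (a b s τ : ℝ) :
    ((a + b) ^ 2 - τ - 2 * s * (a + b)) ^ 2 - discr a b s τ =
      4 * ((a + b) ^ 2 - τ) * ((s - a) * (s - b)) := by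
  unfold discr; ring

theorem sq_sub_discr_lower (a b s τ : ℝ) :
    ((a - b) ^ 2 - τ - 2 * s * (a - b)) ^ 2 - discr a b s τ =
      4 * ((a - b) ^ 2 - τ) * ((s - a) * (s + b)) := by
  unfold discr; ring

theorem sq_sub_discr_zero (a b s τ : ℝ) :
    (a ^ 2 - b ^ 2 - τ) ^ 2 - discr a b s τ = 4 * τ * ((b - s) * (b + s)) := by
  unfold discr; ring

theorem sq_add_discr_upper (a b s τ : ℝ) :
    ((a + b) ^ 2 - τ + 2 * s * (a + b)) ^ 2 - discr a b s τ =
      4 * ((a + b) ^ 2 - τ) * ((s + a) * (s + b)) := by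
  unfold discr; ring

theorem sq_add_discr_lower (a b s τ : ℝ) :
    ((a - b) ^ 2 - τ + 2 * s * (a - b)) ^ 2 - discr a b s τ =
      4 * ((a - b) ^ 2 - τ) * ((s + a) * (s - b)) := by
  unfold discr; ring

theorem discr_eq (a b s τ : ℝ) :
    discr a b s τ = ((a + b) ^ 2 - τ) * ((a - b) ^ 2 - τ) + 4 * s ^ 2 * τ := by
  unfold discr; ring

/-- For `{p, q} = {a - b, a + b}` and `u = -τ`, the hypothesis `h` is `discr ≥ 0`. If the conclusion
failed, squaring it and eliminating `s²` would give `u² ≤ p² q²`. This fixes the sign of `E - 2sξ`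
at a vertex; the next two lemmas do so by the same elimination in other ranges of `τ`. -/
theorem two_mul_lt_of_discr_nonneg {p q u : ℝ} (hp : 0 < p) (hq : 0 < q)
    (hu : p * q < u) (h : 4 * s ^ 2 * u ≤ (p ^ 2 + u) * (q ^ 2 + u)) : 2 * s * p < p ^ 2 + u := by
  have hpq : 0 < p * q := mul_pos hp hq
  have hu0 : 0 < u := hpq.trans hu
  by_contra! hc
  have h1 : (p ^ 2 + u) ^ 2 ≤ (2 * s * p) ^ 2 := by gcongr
  have h2 : u * (p ^ 2 + u) ^ 2 ≤ p ^ 2 * ((p ^ 2 + u) * (q ^ 2 + u)) := by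
    nlinarith [mul_le_mul_of_nonneg_left h (sq_nonneg p), mul_le_mul_of_nonneg_left h1 hu0.le]
  have h3 : u * (p ^ 2 + u) ≤ p ^ 2 * (q ^ 2 + u) := by
    have : 0 < p ^ 2 + u := by positivity
    refine le_of_mul_le_mul_left ?_ this
    linarith
  nlinarith

theorem sub_lt_two_mul_of_discr_nonneg {p q : ℝ} (hp : 0 < p) (hq : 0 < q) (hs : 0 ≤ s)
    (hτ : p * q < τ) (h : (p ^ 2 - τ) * (τ - q ^ 2) ≤ 4 * s ^ 2 * τ) (hpτ : τ < p ^ 2) :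
    p ^ 2 - τ < 2 * s * p := by
  have hτ0 : 0 < τ := (mul_pos hp hq).trans hτ
  by_contra! hc
  have h1 : (2 * s * p) ^ 2 ≤ (p ^ 2 - τ) ^ 2 := by gcongr
  have h2 : (p ^ 2 - τ) * (p ^ 2 * (τ - q ^ 2)) ≤ (p ^ 2 - τ) * (τ * (p ^ 2 - τ)) := by
    nlinarith [mul_le_mul_of_nonneg_left h (sq_nonneg p), mul_le_mul_of_nonneg_left h1 hτ0.le]
  have h3 := le_of_mul_le_mul_left h2 (sub_pos.2 hpτ)
  nlinarith [mul_pos hp hq]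

theorem sub_lt_two_mul_of_discr_nonneg' {p q : ℝ} (hp : 0 < p) (hs : 0 ≤ s)
    (hτ : τ < p * q) (h : (τ - p ^ 2) * (q ^ 2 - τ) ≤ 4 * s ^ 2 * τ) (hpτ : p ^ 2 < τ) :
    τ - p ^ 2 < 2 * s * p := by
  have hτ0 : 0 < τ := (pow_pos hp 2).trans hpτ
  by_contra! hc
  have h1 : (2 * s * p) ^ 2 ≤ (τ - p ^ 2) ^ 2 := by gcongr
  have h2 : (τ - p ^ 2) * (p ^ 2 * (q ^ 2 - τ)) ≤ (τ - p ^ 2) * (τ * (τ - p ^ 2)) := by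
    nlinarith [mul_le_mul_of_nonneg_left h (sq_nonneg p), mul_le_mul_of_nonneg_left h1 hτ0.le]
  have h3 := le_of_mul_le_mul_left h2 (sub_pos.2 hpτ)
  nlinarith

/-! ### Attained pairs are admissible. -/

theorem AttainedAt.discr_nonneg (h : AttainedAt a b s τ x U) : 0 ≤ discr a b s τ :=
  (sq_nonneg _).trans h.2.2.1

/-- If `E - 2sξ` exceeds `√D` at all three vertices, it does so on the whole triangle, against `(E -
2sξ)² ≤ D`. -/
theorem AttainedAt.not_forall_vertex_pos (hb : 0 < b) (hab : b < a) (h : AttainedAt a b s τ x U)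
    (h₀ : discr a b s τ < (a ^ 2 - b ^ 2 - τ) ^ 2)
    (h₁ : discr a b s τ < ((a - b) ^ 2 - τ - 2 * s * (a - b)) ^ 2)
    (h₂ : discr a b s τ < ((a + b) ^ 2 - τ - 2 * s * (a + b)) ^ 2)
    (k₀ : 0 ≤ a ^ 2 - b ^ 2 - τ) (k₁ : 0 ≤ (a - b) ^ 2 - τ - 2 * s * (a - b))
    (k₂ : 0 ≤ (a + b) ^ 2 - τ - 2 * s * (a + b)) : False := by
  have e := (abs_le.1 (Real.abs_le_sqrt h.2.2.1)).2
  have := h.1.affine_pos hb hab (A := -2 * s) (B := 1) (C := -τ - √(discr a b s τ))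
    (by linarith [(Real.sqrt_lt' (lt_of_le_of_ne k₀ (by
      intro h'; rw [← h'] at h₀; linarith [h.discr_nonneg]))).2 h₀])
    (by linarith [(Real.sqrt_lt' (lt_of_le_of_ne k₁ (by
      intro h'; rw [← h'] at h₁; linarith [h.discr_nonneg]))).2 h₁])
    (by linarith [(Real.sqrt_lt' (lt_of_le_of_ne k₂ (by
      intro h'; rw [← h'] at h₂; linarith [h.discr_nonneg]))).2 h₂])
  linarith

theorem AttainedAt.not_forall_vertex_neg (hb : 0 < b) (hab : b < a) (h : AttainedAt a b s τ x U)
    (h₀ : discr a b s τ < (a ^ 2 - b ^ 2 - τ) ^ 2)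
    (h₁ : discr a b s τ < ((a - b) ^ 2 - τ - 2 * s * (a - b)) ^ 2)
    (h₂ : discr a b s τ < ((a + b) ^ 2 - τ - 2 * s * (a + b)) ^ 2)
    (k₀ : a ^ 2 - b ^ 2 - τ ≤ 0) (k₁ : (a - b) ^ 2 - τ - 2 * s * (a - b) ≤ 0)
    (k₂ : (a + b) ^ 2 - τ - 2 * s * (a + b) ≤ 0) : False := by
  have e := (abs_le.1 (Real.abs_le_sqrt h.2.2.1)).1
  have aux : ∀ v : ℝ, discr a b s τ < v ^ 2 → v ≤ 0 → √(discr a b s τ) + v < 0 := by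
    intro v hv hv0
    have : v ≠ 0 := by rintro rfl; linarith [h.discr_nonneg]
    have hv1 : 0 < -v := by linarith [lt_of_le_of_ne hv0 this]
    linarith [(Real.sqrt_lt' hv1).2 (by linarith [neg_sq v] : discr a b s τ < (-v) ^ 2)]
  have := h.1.affine_neg hb hab (A := -2 * s) (B := 1) (C := -τ + √(discr a b s τ))
    (by linarith [aux _ h₀ k₀]) (by linarith [aux _ h₁ k₁]) (by linarith [aux _ h₂ k₂])
  linarith

theorem AttainedAt.lt_of_pos (hb : 0 < b) (hab : b < a) (h : AttainedAt a b s τ x U)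
    (hs : 0 < s) : τ < (a + b) ^ 2 := by
  have := pos_of_mul_pos_right h.2.1 hs.le
  linarith [h.1.le_sq hb hab]

theorem AttainedAt.lt_of_neg (hb : 0 < b) (hab : b < a) (h : AttainedAt a b s τ x U)
    (hs : s < 0) : (a - b) ^ 2 < τ := by
  have : U - τ < 0 := by nlinarith [h.2.1]
  linarith [h.1.sq_le hb hab]

theorem AttainedAt.le_of_neg (hb : 0 < b) (hab : b < a) (h : AttainedAt a b s τ x U)
    (hs : s < 0) : -a ≤ s := by
  by_contra! hc
  have ha : 0 < a := hb.trans hab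
  have hm := h.lt_of_neg hb hab hs
  have hE : U - τ < 0 := by nlinarith [h.2.1]
  have hx := h.1.nonneg hb
  have hg : √(discr a b s τ) ≤ -(U - τ + 2 * s * x) := by
    rw [Real.sqrt_le_left (by nlinarith)]
    linarith [h.2.2.2, neg_sq (U - τ + 2 * s * x)]
  rcases le_or_gt τ ((a + b) ^ 2) with h1 | h1
  · have hτ : 0 < τ := lt_of_le_of_lt (sq_nonneg _) hm
    -- With `k = -s/a > 1`, the edge inequality `2aξ ≤ U + r²` gives `√D ≤ τ - U + k(U + r²)`, while
    -- `k(τ + r²) ≤ √D`. Hence `k(τ - U) ≤ τ - U`, impossible since `τ > U`.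
    have e1 : (-s / a * (τ + (a ^ 2 - b ^ 2))) ^ 2 ≤ discr a b s τ := by
      have : discr a b s τ - (-s / a * (τ + (a ^ 2 - b ^ 2))) ^ 2 =
          ((a + b) ^ 2 - τ) * (τ - (a - b) ^ 2) * ((s ^ 2 - a ^ 2) / a ^ 2) := by
        unfold discr; field_simp; ring
      have h2 : 0 ≤ (s ^ 2 - a ^ 2) / a ^ 2 := div_nonneg (by nlinarith) (by positivity)
      have := mul_nonneg (mul_nonneg (sub_nonneg.2 h1) (sub_nonneg.2 hm.le)) h2
      linarith
    have e2 := Real.le_sqrt_of_sq_le e1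
    have hk : 1 < -s / a := by rw [lt_div_iff₀ ha]; linarith
    have e3 : -(2 * s * x) ≤ -s / a * (U + (a ^ 2 - b ^ 2)) := by
      have := mul_le_mul_of_nonneg_left h.1.2.2 (by linarith : 0 ≤ -s / a)
      have e : -s / a * (2 * a * x) = -(2 * s * x) := by field_simp
      linarith
    nlinarith
  -- Above `(a + b)²` the vertices suffice: `E + 2sξ + √D` is positive at all three, against `hg`.
  · have aux : ∀ v : ℝ, v ^ 2 < discr a b s τ → 0 < √(discr a b s τ) + v := by
      intro v hv
      linarith [Real.lt_sqrt_of_sq_lt (by linarith [neg_sq v] : (-v) ^ 2 < discr a b s τ)]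
    have h3 := h.1.affine_pos hb hab (A := 2 * s) (B := 1) (C := -τ + √(discr a b s τ))
      (by
        have := aux (a ^ 2 - b ^ 2 - τ) (by
          have := sq_sub_discr_zero a b s τ
          nlinarith [mul_pos (by linarith : 0 < τ - (a + b) ^ 2) (by nlinarith : 0 < (b - s) * (-(b + s))),
            mul_pos (by positivity : 0 < (a + b) ^ 2) (by nlinarith : 0 < (b - s) * (-(b + s)))])
        linarith)
      (by
        have := aux ((a - b) ^ 2 - τ + 2 * s * (a - b)) (by
          have := sq_add_discr_lower a b s τ
          nlinarith [mul_pos (sub_pos.2 hm) (by nlinarith : 0 < (s + a) * (s - b))])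
        linarith)
      (by
        have := aux ((a + b) ^ 2 - τ + 2 * s * (a + b)) (by
          have := sq_add_discr_upper a b s τ
          nlinarith [mul_pos (sub_pos.2 h1) (by nlinarith : 0 < (s + a) * (s + b))])
        linarith)
    linarith

theorem AttainedAt.admissible (hb : 0 < b) (hab : b < a) (h : AttainedAt a b s τ x U) :
    Admissible a b s τ := by
  have ha : 0 < a := hb.trans hab
  have hm : 0 < a - b := sub_pos.2 hab
  have hp : 0 < a + b := by linarith
  have hr : (a - b) * (a + b) = a ^ 2 - b ^ 2 := by ring
  have hr0 : 0 < a ^ 2 - b ^ 2 := hr ▸ mul_pos hm hp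
  have hmr : (a - b) ^ 2 < a ^ 2 - b ^ 2 := by nlinarith
  have hpr : a ^ 2 - b ^ 2 < (a + b) ^ 2 := by nlinarith
  have hD := h.discr_nonneg
  have hD' := discr_eq a b s τ
  have v0 := sq_sub_discr_zero a b s τ
  have v1 := sq_sub_discr_lower a b s τ
  have v2 := sq_sub_discr_upper a b s τ
  rcases lt_trichotomy s 0 with hs | rfl | hs
  · have ht := h.lt_of_neg hb hab hs
    refine .inr ⟨hs.le, ht.le, hD, h.le_of_neg hb hab hs, ?_⟩
    by_contra! hc
    have w1 : 0 < (b - s) * (b + s) := mul_pos (by linarith) (by linarith)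
    have w2 : 0 < (a - s) * (b + s) := mul_pos (by linarith) (by linarith)
    have w3 : 0 < (a - s) * (b - s) := mul_pos (by linarith) (by linarith)
    -- The factored differences show only that `|E - 2sξ| > √D` at each vertex; `key` supplies the
    -- sign at the vertex `(a - b, (a - b)²)`, the only one where it is not immediate.
    have key := sub_lt_two_mul_of_discr_nonneg' (s := -s) (p := a - b) (q := a + b) (τ := τ) hm
      (by linarith) (by linarith) (by linarith [neg_sq s]) ht
    have e0 : 0 < τ * ((b - s) * (b + s)) := mul_pos (by nlinarith) w1
    have e1 : 0 < (τ - (a - b) ^ 2) * ((a - s) * (b + s)) := mul_pos (by linarith) w2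
    have e2 : 0 < ((a + b) ^ 2 - τ) * ((a - s) * (b - s)) := mul_pos (by linarith) w3
    exact h.not_forall_vertex_pos hb hab (by linarith) (by linarith) (by linarith) (by linarith)
      (by linarith) (by nlinarith)
  · exact absurd h.2.1 (by simp)
  · have ht := h.lt_of_pos hb hab hs
    refine .inl ⟨hs.le, ht.le, hD, ?_, ?_⟩
    · by_contra! hc
      have hτ : τ < 0 := by linarith
      have e0 : 0 < -τ * ((s - b) * (b + s)) :=
        mul_pos (by linarith) (mul_pos (by linarith) (by linarith))
      have e1 : 0 < ((a - b) ^ 2 - τ) * ((s - a) * (s + b)) :=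
        mul_pos (by nlinarith) (mul_pos (by linarith) (by linarith))
      have e2 : 0 < ((a + b) ^ 2 - τ) * ((s - a) * (s - b)) :=
        mul_pos (by linarith) (mul_pos (by linarith) (by linarith))
      have key₁ := two_mul_lt_of_discr_nonneg (s := s) (p := a - b) (q := a + b) (u := -τ) hm hp
        (by linarith) (by linarith)
      have key₂ := two_mul_lt_of_discr_nonneg (s := s) (p := a + b) (q := a - b) (u := -τ) hp hm
        (by linarith) (by linarith)
      exact h.not_forall_vertex_pos hb hab (by linarith) (by linarith) (by linarith) (by linarith)
        (by linarith) (by linarith)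
    · by_contra! hc
      have e0 : 0 < τ * ((b - s) * (b + s)) :=
        mul_pos (by linarith) (mul_pos (by linarith) (by linarith))
      have e1 : 0 < (τ - (a - b) ^ 2) * ((a - s) * (s + b)) :=
        mul_pos (by linarith) (mul_pos (by linarith) (by linarith))
      have e2 : 0 < ((a + b) ^ 2 - τ) * ((a - s) * (b - s)) :=
        mul_pos (by linarith) (mul_pos (by linarith) (by linarith))
      have key := sub_lt_two_mul_of_discr_nonneg (s := s) (p := a + b) (q := a - b) (τ := τ) hp hm
        hs.le (by linarith) (by linarith) ht
      exact h.not_forall_vertex_neg hb hab (by linarith) (by linarith) (by linarith) (by linarith)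
        (by nlinarith) (by linarith)

/-! ### Admissible pairs are attained on the triangle. -/

theorem inTriangle_zero (hb : 0 < b) (hab : b < a) : InTriangle a b 0 (a ^ 2 - b ^ 2) := by
  refine ⟨by simp, by simp, ?_⟩
  nlinarith

theorem inTriangle_lower (hb : 0 < b) (hab : b < a) : InTriangle a b (a - b) ((a - b) ^ 2) := by
  refine ⟨?_, ?_, ?_⟩ <;> nlinarith

theorem inTriangle_upper (hb : 0 < b) (hab : b < a) : InTriangle a b (a + b) ((a + b) ^ 2) := by
  refine ⟨?_, ?_, ?_⟩ <;> nlinarith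

theorem InTriangle.exists_affine_eq_zero {x₀ U₀ x₁ U₁ A B C : ℝ} (h₀ : InTriangle a b x₀ U₀)
    (h₁ : InTriangle a b x₁ U₁) (k₀ : A * x₀ + B * U₀ + C ≤ 0) (k₁ : 0 ≤ A * x₁ + B * U₁ + C) :
    ∃ l : ℝ, 0 ≤ l ∧ l ≤ 1 ∧ ∃ x U, x = (1 - l) * x₀ + l * x₁ ∧ U = (1 - l) * U₀ + l * U₁ ∧
      InTriangle a b x U ∧ A * x + B * U + C = 0 := by
  obtain ⟨l, hl0, hl1, hl⟩ : ∃ l : ℝ, 0 ≤ l ∧ l ≤ 1 ∧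
      (1 - l) * (A * x₀ + B * U₀ + C) + l * (A * x₁ + B * U₁ + C) = 0 := by
    generalize A * x₀ + B * U₀ + C = p at *
    generalize A * x₁ + B * U₁ + C = q at *
    rcases eq_or_lt_of_le (by linarith : p ≤ q) with h | h
    · exact ⟨0, le_rfl, zero_le_one, by simp; linarith⟩
    · have h' : 0 < q - p := by linarith
      refine ⟨-p / (q - p), div_nonneg (by linarith) h'.le, ?_, ?_⟩
      · rw [div_le_one h']; linarith
      · field_simp; ring
  refine ⟨l, hl0, hl1, _, _, rfl, rfl, ?_, by linarith⟩
  have hl1' := sub_nonneg.2 hl1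
  obtain ⟨a1, a2, a3⟩ := h₀
  obtain ⟨b1, b2, b3⟩ := h₁
  refine ⟨?_, ?_, ?_⟩
  · linarith [mul_le_mul_of_nonneg_left a1 hl1', mul_le_mul_of_nonneg_left b1 hl0]
  · linarith [mul_le_mul_of_nonneg_left a2 hl1', mul_le_mul_of_nonneg_left b2 hl0]
  · linarith [mul_le_mul_of_nonneg_left a3 hl1', mul_le_mul_of_nonneg_left b3 hl0]

/-- One of the two square bounds may be taken as an equality; the other then follows from `(E +
2sξ)² - (E - 2sξ)² = 8sEξ ≥ 0`. -/
theorem AttainedAt.of_add_eq (h : InTriangle a b x U) (hx : 0 ≤ x) (hs : 0 < s * (U - τ))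
    (he : (U - τ + 2 * s * x) ^ 2 = discr a b s τ) : AttainedAt a b s τ x U :=
  ⟨h, hs, by nlinarith [mul_nonneg hs.le hx], he.ge⟩

theorem AttainedAt.of_sub_eq (h : InTriangle a b x U) (hx : 0 ≤ x) (hs : 0 < s * (U - τ))
    (he : (U - τ - 2 * s * x) ^ 2 = discr a b s τ) : AttainedAt a b s τ x U :=
  ⟨h, hs, he.le, by nlinarith [mul_nonneg hs.le hx]⟩

/-- A form `E ± 2sξ - √D` changes sign along an edge, and its zero is the required point. Which edge
and which sign depend on the side of `(a - b)²` on which `τ` lies. The point must avoid the vertex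
with `ξ = 0`, because the later reconstruction divides by `ξ`. -/
theorem exists_attainedAt_of_pos_of_lt (hb : 0 < b) (hab : b < a) (hs : 0 < s) (hsb : s < b)
    (hD : 0 ≤ discr a b s τ) (hτ : τ ≤ a ^ 2 - b ^ 2) : ∃ x U, 0 < x ∧ AttainedAt a b s τ x U := by
  have hm : 0 < a - b := sub_pos.2 hab
  have hp : 0 < a + b := by linarith
  have hr0 : 0 < a ^ 2 - b ^ 2 := by nlinarith
  have hpr : a ^ 2 - b ^ 2 < (a + b) ^ 2 := by nlinarith
  have v0 := sq_sub_discr_zero a b s τ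
  have v1 := sq_sub_discr_lower a b s τ
  have g1 := sq_add_discr_lower a b s τ
  have g2 := sq_add_discr_upper a b s τ
  have hd := Real.sq_sqrt hD
  have hd0 := Real.sqrt_nonneg (discr a b s τ)
  rcases lt_or_ge τ ((a - b) ^ 2) with h1 | h1
  · have e1 : 0 ≤ ((a - b) ^ 2 - τ) * ((s + a) * (b - s)) :=
      mul_nonneg (by linarith) (mul_nonneg (by linarith) (by linarith))
    have e2 : 0 ≤ ((a + b) ^ 2 - τ) * ((s + a) * (s + b)) :=
      mul_nonneg (by linarith) (mul_nonneg (by linarith) (by linarith))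
    have k1 := Real.le_sqrt_of_sq_le (by linarith :
      ((a - b) ^ 2 - τ + 2 * s * (a - b)) ^ 2 ≤ discr a b s τ)
    have k2 : √(discr a b s τ) ≤ (a + b) ^ 2 - τ + 2 * s * (a + b) :=
      Real.sqrt_le_iff.2 ⟨by nlinarith, by linarith⟩
    obtain ⟨l, hl0, hl1, x, U, hx, -, ht, h⟩ := (inTriangle_lower hb hab).exists_affine_eq_zero
      (inTriangle_upper hb hab) (A := 2 * s) (B := 1) (C := -τ - √(discr a b s τ))
      (by linarith) (by linarith)
    have hx0 : 0 < x := by linarith [mul_nonneg hl0 hb.le]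
    refine ⟨x, U, hx0, .of_add_eq ht hx0.le (mul_pos hs (by linarith [ht.sq_le hb hab])) ?_⟩
    rw [← hd]
    congr 1
    linarith
  · have e0 : 0 < τ * ((b - s) * (b + s)) :=
      mul_pos (lt_of_lt_of_le (by positivity) h1) (mul_pos (by linarith) (by linarith))
    have k0 : √(discr a b s τ) < a ^ 2 - b ^ 2 - τ := by
      refine (Real.sqrt_lt' (lt_of_le_of_ne (by linarith) ?_)).2 (by linarith)
      intro h; rw [← h] at v0; linarith
    obtain ⟨l, hl0, hl1, x, U, hx, hU, ht, h⟩ := (inTriangle_lower hb hab).exists_affine_eq_zero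
      (inTriangle_zero hb hab) (A := -2 * s) (B := 1) (C := -τ - √(discr a b s τ))
      (by nlinarith) (by linarith)
    have hx0 : 0 < x := by
      have : l ≠ 1 := by
        rintro rfl
        have hx' : x = 0 := by linarith
        rw [hx', hU] at h
        linarith
      have : 0 < 1 - l := sub_pos.2 (lt_of_le_of_ne hl1 this)
      rw [hx]
      have := mul_pos this hm
      linarith
    have hsx := mul_pos hs hx0
    refine ⟨x, U, hx0, .of_sub_eq ht hx0.le (mul_pos hs (by linarith)) ?_⟩
    rw [← hd]
    congr 1
    linarith

theorem exists_attainedAt_of_gt_of_ge (hb : 0 < b) (hab : b < a) (hs : a < s)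
    (hD : 0 ≤ discr a b s τ) (hτ : a ^ 2 - b ^ 2 ≤ τ) (hτ' : τ < (a + b) ^ 2) :
    ∃ x U, 0 < x ∧ AttainedAt a b s τ x U := by
  have ha : 0 < a := hb.trans hab
  have hs0 : 0 < s := ha.trans hs
  have hm : 0 < a - b := sub_pos.2 hab
  have hp : 0 < a + b := by linarith
  have hr0 : 0 < a ^ 2 - b ^ 2 := by nlinarith
  have hmr : (a - b) ^ 2 < a ^ 2 - b ^ 2 := by nlinarith
  have g1 := sq_add_discr_lower a b s τ
  have g2 := sq_add_discr_upper a b s τ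
  have hd := Real.sq_sqrt hD
  have e2 : 0 ≤ ((a + b) ^ 2 - τ) * ((s + a) * (s + b)) :=
    mul_nonneg (by linarith) (mul_nonneg (by linarith) (by linarith))
  have k2 : √(discr a b s τ) ≤ (a + b) ^ 2 - τ + 2 * s * (a + b) :=
    Real.sqrt_le_iff.2 ⟨by nlinarith, by linarith⟩
  have e1 : 0 ≤ (τ - (a - b) ^ 2) * ((s + a) * (s - b)) :=
    mul_nonneg (by linarith) (mul_nonneg (by linarith) (by linarith))
  have k1 := Real.le_sqrt_of_sq_le (by linarith :
    ((a - b) ^ 2 - τ + 2 * s * (a - b)) ^ 2 ≤ discr a b s τ)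
  obtain ⟨l, hl0, hl1, x, U, hx, hU, ht, h⟩ := (inTriangle_lower hb hab).exists_affine_eq_zero
    (inTriangle_upper hb hab) (A := 2 * s) (B := 1) (C := -τ - √(discr a b s τ))
    (by linarith) (by linarith)
  have hx0 : 0 < x := by linarith [mul_nonneg hl0 hb.le]
  -- On this edge `2aξ = U + r²`. If `U ≤ τ`, then `√D = E + 2sξ ≤ (s/a)(τ + r²)`, whereas `s > a`
  -- makes the last quantity smaller than `√D`.
  have hE : τ < U := by
    by_contra! hc
    have hUx : U = 2 * a * x - (a ^ 2 - b ^ 2) := by rw [hU, hx]; ring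
    have l1 : (s / a * (τ + (a ^ 2 - b ^ 2))) ^ 2 < discr a b s τ := by
      have : discr a b s τ - (s / a * (τ + (a ^ 2 - b ^ 2))) ^ 2 =
          ((a + b) ^ 2 - τ) * (τ - (a - b) ^ 2) * ((s ^ 2 - a ^ 2) / a ^ 2) := by
        unfold discr; field_simp; ring
      have h2 : 0 < (s ^ 2 - a ^ 2) / a ^ 2 := div_pos (by nlinarith) (by positivity)
      have := mul_pos (mul_pos (sub_pos.2 hτ') (by linarith : 0 < τ - (a - b) ^ 2)) h2
      linarith
    have l2 := Real.lt_sqrt_of_sq_lt l1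
    have l3 : 2 * s * x = s / a * (U + (a ^ 2 - b ^ 2)) := by rw [hUx]; field_simp; ring
    have l4 : 0 ≤ s / a * (τ - U) := mul_nonneg (div_pos hs0 ha).le (sub_nonneg.2 hc)
    linarith
  refine ⟨x, U, hx0, .of_add_eq ht hx0.le (mul_pos hs0 (by linarith)) ?_⟩
  rw [← hd]
  congr 1
  linarith

theorem exists_attainedAt_of_gt (hb : 0 < b) (hab : b < a) (hs : a < s)
    (hD : 0 ≤ discr a b s τ) (hτ : -(a ^ 2 - b ^ 2) ≤ τ) (hτ' : τ < (a + b) ^ 2) :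
    ∃ x U, 0 < x ∧ AttainedAt a b s τ x U := by
  have ha : 0 < a := hb.trans hab
  have hs0 : 0 < s := ha.trans hs
  have hm : 0 < a - b := sub_pos.2 hab
  have hp : 0 < a + b := by linarith
  have hr0 : 0 < a ^ 2 - b ^ 2 := by nlinarith
  have hmr : (a - b) ^ 2 < a ^ 2 - b ^ 2 := by nlinarith
  have hpr : a ^ 2 - b ^ 2 < (a + b) ^ 2 := by nlinarith
  have v0 := sq_sub_discr_zero a b s τ
  have v1 := sq_sub_discr_lower a b s τ
  have g2 := sq_add_discr_upper a b s τ
  have hd := Real.sq_sqrt hD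
  have hd0 := Real.sqrt_nonneg (discr a b s τ)
  have e2 : 0 ≤ ((a + b) ^ 2 - τ) * ((s + a) * (s + b)) :=
    mul_nonneg (by linarith) (mul_nonneg (by linarith) (by linarith))
  have k2 : √(discr a b s τ) ≤ (a + b) ^ 2 - τ + 2 * s * (a + b) :=
    Real.sqrt_le_iff.2 ⟨by nlinarith, by linarith⟩
  rcases lt_or_ge τ ((a - b) ^ 2) with h1 | h1
  · have e1 : 0 ≤ ((a - b) ^ 2 - τ) * ((s - a) * (s + b)) :=
      mul_nonneg (by linarith) (mul_nonneg (by linarith) (by linarith))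
    -- The right side is nonnegative because `2s(a - b) > 2a(a - b) = (a - b)² + r² ≥ (a - b)² - τ`;
    -- this is where `τ ≥ -r²` enters.
    have k1 : √(discr a b s τ) ≤ -((a - b) ^ 2 - τ - 2 * s * (a - b)) :=
      Real.sqrt_le_iff.2 ⟨by nlinarith, by rw [neg_sq]; linarith⟩
    obtain ⟨l, hl0, hl1, x, U, hx, hU, ht, h⟩ := (inTriangle_lower hb hab).exists_affine_eq_zero
      (inTriangle_zero hb hab) (A := -2 * s) (B := 1) (C := -τ + √(discr a b s τ))
      (by linarith) (by linarith)
    have hx0 : 0 < x := by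
      have : l ≠ 1 := by
        rintro rfl
        have hx' : x = 0 := by linarith
        rw [hx', hU] at h
        linarith
      have : 0 < 1 - l := sub_pos.2 (lt_of_le_of_ne hl1 this)
      rw [hx]
      have := mul_pos this hm
      linarith
    refine ⟨x, U, hx0, .of_sub_eq ht hx0.le (mul_pos hs0 (by linarith [ht.sq_le hb hab])) ?_⟩
    rw [← hd, ← neg_sq]
    congr 1
    linarith
  have hτ0 : 0 < τ := lt_of_lt_of_le (by positivity) h1
  rcases lt_or_ge τ (a ^ 2 - b ^ 2) with h2 | h2
  · have e0 : 0 < τ * ((s - b) * (b + s)) :=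
      mul_pos hτ0 (mul_pos (by linarith) (by linarith))
    have k0 : a ^ 2 - b ^ 2 - τ < √(discr a b s τ) := Real.lt_sqrt_of_sq_lt (by linarith)
    obtain ⟨l, hl0, hl1, x, U, hx, hU, ht, h⟩ := (inTriangle_zero hb hab).exists_affine_eq_zero
      (inTriangle_upper hb hab) (A := 2 * s) (B := 1) (C := -τ - √(discr a b s τ))
      (by linarith) (by linarith)
    have hx0 : 0 < x := by
      have : l ≠ 0 := by
        rintro rfl
        have hx' : x = 0 := by linarith
        rw [hx', hU] at h
        linarith
      have : 0 < l := lt_of_le_of_ne hl0 this.symm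
      rw [hx]
      have := mul_pos this hp
      linarith
    have hU' : a ^ 2 - b ^ 2 ≤ U := by linarith [mul_nonneg hl0 (sub_nonneg.2 hpr.le)]
    refine ⟨x, U, hx0, .of_add_eq ht hx0.le (mul_pos hs0 (by linarith)) ?_⟩
    rw [← hd]
    congr 1
    linarith
  · exact exists_attainedAt_of_gt_of_ge hb hab hs hD h2 hτ'

theorem exists_attainedAt_of_neg_of_gt (hb : 0 < b) (hab : b < a) (hs : s < 0) (hsb : -b < s)
    (hD : 0 ≤ discr a b s τ) (hτ : a ^ 2 - b ^ 2 ≤ τ) :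
    ∃ x U, 0 < x ∧ AttainedAt a b s τ x U := by
  have hm : 0 < a - b := sub_pos.2 hab
  have hp : 0 < a + b := by linarith
  have hr0 : 0 < a ^ 2 - b ^ 2 := by nlinarith
  have hmr : (a - b) ^ 2 < a ^ 2 - b ^ 2 := by nlinarith
  have v0 := sq_sub_discr_zero a b s τ
  have g1 := sq_add_discr_lower a b s τ
  have g2 := sq_add_discr_upper a b s τ
  have hd := Real.sq_sqrt hD
  have hd0 := Real.sqrt_nonneg (discr a b s τ)
  rcases lt_or_ge ((a + b) ^ 2) τ with h1 | h1
  · have e1 : 0 ≤ (τ - (a - b) ^ 2) * ((s + a) * (b - s)) :=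
      mul_nonneg (by linarith) (mul_nonneg (by linarith) (by linarith))
    have e2 : 0 ≤ (τ - (a + b) ^ 2) * ((s + a) * (s + b)) :=
      mul_nonneg (by linarith) (mul_nonneg (by linarith) (by linarith))
    have k1 : √(discr a b s τ) ≤ -((a - b) ^ 2 - τ + 2 * s * (a - b)) :=
      Real.sqrt_le_iff.2 ⟨by nlinarith, by rw [neg_sq]; linarith⟩
    have k2 : -((a + b) ^ 2 - τ + 2 * s * (a + b)) ≤ √(discr a b s τ) :=
      Real.le_sqrt_of_sq_le (by rw [neg_sq]; linarith)
    obtain ⟨l, hl0, hl1, x, U, hx, -, ht, h⟩ := (inTriangle_lower hb hab).exists_affine_eq_zero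
      (inTriangle_upper hb hab) (A := 2 * s) (B := 1) (C := -τ + √(discr a b s τ))
      (by linarith) (by linarith)
    have hx0 : 0 < x := by linarith [mul_nonneg hl0 hb.le]
    refine ⟨x, U, hx0, .of_add_eq ht hx0.le
      (mul_pos_of_neg_of_neg hs (by linarith [ht.le_sq hb hab])) ?_⟩
    rw [← hd, ← neg_sq]
    congr 1
    linarith
  · have e0 : 0 < τ * ((b - s) * (b + s)) :=
      mul_pos (by linarith) (mul_pos (by linarith) (by linarith))
    have k0 : √(discr a b s τ) < -(a ^ 2 - b ^ 2 - τ) := by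
      refine (Real.sqrt_lt' (lt_of_le_of_ne (by linarith) ?_)).2 (by rw [neg_sq]; linarith)
      intro h; rw [← neg_sq, ← h] at v0; linarith
    obtain ⟨l, hl0, hl1, x, U, hx, hU, ht, h⟩ := (inTriangle_zero hb hab).exists_affine_eq_zero
      (inTriangle_upper hb hab) (A := -2 * s) (B := 1) (C := -τ + √(discr a b s τ))
      (by linarith) (by nlinarith)
    have hx0 : 0 < x := by
      have : l ≠ 0 := by
        rintro rfl
        have hx' : x = 0 := by linarith
        rw [hx', hU] at h
        linarith
      have : 0 < l := lt_of_le_of_ne hl0 this.symm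
      rw [hx]
      have := mul_pos this hp
      linarith
    have hsx := mul_neg_of_neg_of_pos hs hx0
    refine ⟨x, U, hx0, .of_sub_eq ht hx0.le (mul_pos_of_neg_of_neg hs (by linarith)) ?_⟩
    rw [← hd, ← neg_sq]
    congr 1
    linarith

theorem Admissible.exists_attainedAt (hb : 0 < b) (hab : b < a) (hs : s ≠ 0)
    (h : Admissible a b s τ) (h₁ : 0 < s → τ < (a + b) ^ 2) (h₂ : s < 0 → (a - b) ^ 2 < τ) :
    ∃ x U, 0 < x ∧ AttainedAt a b s τ x U := by
  have hm : 0 < a - b := sub_pos.2 hab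
  have hp : 0 < a + b := by linarith
  rcases h with ⟨k1, k2, k3, k4, k5⟩ | ⟨k1, k2, k3, k4, k5⟩
  · have hs0 : 0 < s := lt_of_le_of_ne k1 hs.symm
    rcases lt_or_ge s b with h3 | h3
    · exact exists_attainedAt_of_pos_of_lt hb hab hs0 h3 k3 (k5.resolve_left (by linarith))
    rcases lt_or_ge a s with h4 | h4
    · exact exists_attainedAt_of_gt hb hab h4 k3 (k4.resolve_left (by linarith)) (h₁ hs0)
    -- For `b ≤ s ≤ a` the vertex `(a + b, (a + b)²)` serves for every `τ` below `(a + b)²`, by the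
    -- signs in the factored differences.
    have v2 := sq_sub_discr_upper a b s τ
    have g2 := sq_add_discr_upper a b s τ
    have e1 : 0 ≤ ((a + b) ^ 2 - τ) * ((a - s) * (s - b)) :=
      mul_nonneg (by linarith) (mul_nonneg (by linarith) (by linarith))
    have e2 : 0 ≤ ((a + b) ^ 2 - τ) * ((s + a) * (s + b)) :=
      mul_nonneg (by linarith) (mul_nonneg (by linarith) (by linarith))
    exact ⟨_, _, hp, inTriangle_upper hb hab, mul_pos hs0 (by linarith [h₁ hs0]), by linarith,
      by linarith⟩
  · have hs0 : s < 0 := lt_of_le_of_ne k1 hs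
    rcases lt_or_ge (-b) s with h3 | h3
    · exact exists_attainedAt_of_neg_of_gt hb hab hs0 h3 k3 (k5.resolve_left (by linarith))
    -- Symmetrically, for `-a ≤ s ≤ -b` the vertex `(a - b, (a - b)²)` serves.
    have v1 := sq_sub_discr_lower a b s τ
    have g1 := sq_add_discr_lower a b s τ
    have e1 : 0 ≤ (τ - (a - b) ^ 2) * ((a - s) * (-s - b)) :=
      mul_nonneg (by linarith) (mul_nonneg (by linarith) (by linarith))
    have e2 : 0 ≤ (τ - (a - b) ^ 2) * ((s + a) * (b - s)) :=
      mul_nonneg (by linarith) (mul_nonneg (by linarith) (by linarith))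
    exact ⟨_, _, hm, inTriangle_lower hb hab,
      mul_pos_of_neg_of_neg hs0 (by linarith [h₂ hs0]), by linarith, by linarith⟩

end Plane

/-! ### The third subsystem in complex variables. -/

open Complex ComplexConjugate

/-- The equations of a point of the third subsystem with values `(s, τ)` of the integrals, in the
complex variables `x = x₁`, `y = y₁`, `z = z₁`, `w = w₁` and `h = ω₃`. -/
structure Solves (a b s τ : ℝ) (x y z w : ℂ) (h : ℝ) : Prop where
  square : x * conj y + z ^ 2 = ((a ^ 2 - b ^ 2 : ℝ) : ℂ)
  norm : x * conj x + y * conj y + 2 * (z * conj z) = ((2 * (a ^ 2 + b ^ 2) : ℝ) : ℂ)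
  first : conj y * w + x * conj w + z * h + 2 * s * w = 0
  second : x * conj z - y * z - 2 * s * z = 2 * s * w * h
  value : x * conj x + z * conj z - 2 * s * (w * conj w) = τ

theorem x₂_eq (q : State) : x₂ q = conj (x₁ q) := by
  simp only [x₁, x₂, map_add, map_mul, conj_I, conj_ofReal]; ring

theorem y₂_eq (q : State) : y₂ q = conj (y₁ q) := by
  simp only [y₁, y₂, map_add, map_mul, conj_I, conj_ofReal]; ring

theorem z₂_eq (q : State) : z₂ q = conj (z₁ q) := by
  simp only [z₁, z₂, map_add, map_mul, conj_I, conj_ofReal]; ring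

theorem w₂_eq (q : State) : w₂ q = conj (w₁ q) := by
  simp only [w₁, w₂, map_add, map_mul, conj_I, conj_ofReal]; ring

theorem mem_phaseSpace_iff {a b : ℝ} {q : State} : q ∈ phaseSpace a b ↔
    x₁ q * conj (y₁ q) + z₁ q ^ 2 = ((a ^ 2 - b ^ 2 : ℝ) : ℂ) ∧
    x₁ q * conj (x₁ q) + y₁ q * conj (y₁ q) + 2 * (z₁ q * conj (z₁ q)) =
      ((2 * (a ^ 2 + b ^ 2) : ℝ) : ℂ) := by
  rw [← x₂_eq, ← y₂_eq, ← z₂_eq]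
  simp only [phaseSpace, Set.mem_ofPred_eq, dotProduct, Fin.sum_univ_three, Complex.ext_iff, x₁, x₂,
    y₁, y₂, z₁, z₂, pow_two, add_re, sub_re, mul_re, add_im, sub_im, mul_im, ofReal_re, ofReal_im,
    I_re, I_im, re_ofNat, im_ofNat]
  constructor
  · rintro ⟨h1, h2, h3⟩
    refine ⟨⟨?_, ?_⟩, ?_, ?_⟩ <;> linarith
  · rintro ⟨⟨h1, h2⟩, h3, h4⟩
    refine ⟨?_, ?_, ?_⟩ <;> linarith

/-- `e₁` and its conjugate `e₂` together express the first critical equation and `S = s`. Modulo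
them the second critical equation collapses to the conjugate of `Solves.second`, up to the nonzero
factor `2w₁`. -/
theorem secondRelation_mul_eq {q : State} (hw₁ : w₁ q ≠ 0) (hw₂ : w₂ q ≠ 0) (s : ℂ)
    (e₁ : y₂ q * w₁ q + x₁ q * w₂ q + z₁ q * w₃ q + 2 * s * w₁ q = 0)
    (e₂ : y₁ q * w₂ q + x₂ q * w₁ q + z₂ q * w₃ q + 2 * s * w₂ q = 0) :
    secondRelation q =
      2 * w₁ q * (x₂ q * z₁ q - z₂ q * y₂ q - 2 * s * z₂ q - 2 * s * w₂ q * w₃ q) := by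
  have h : secondRelation q * (w₁ q * w₂ q) = w₁ q * w₂ q *
      ((w₂ q * z₁ q + w₁ q * z₂ q) * w₃ q ^ 2 + (w₁ q * w₂ q * (y₁ q + y₂ q)
        + x₁ q * w₂ q ^ 2 + x₂ q * w₁ q ^ 2) * w₃ q + x₁ q * z₂ q * w₂ q + x₂ q * z₁ q * w₁ q
        + (w₁ q * z₂ q - w₂ q * z₁ q) * (y₁ q - y₂ q))
      + w₃ q * (w₂ q ^ 2 * z₁ q ^ 2 + w₁ q ^ 2 * z₂ q ^ 2)
      + w₂ q ^ 3 * x₁ q * z₁ q + w₁ q ^ 3 * x₂ q * z₂ q := by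
    unfold secondRelation
    field_simp
    ring
  refine mul_right_cancel₀ (mul_ne_zero hw₁ hw₂) ?_
  rw [h]
  linear_combination (2 * w₁ q * w₂ q * z₂ q + w₂ q ^ 2 * z₁ q + w₁ q * w₂ q ^ 2 * w₃ q
    - w₁ q * w₂ q * z₂ q) * e₁ +
    (w₁ q ^ 2 * z₂ q + w₁ q ^ 2 * w₂ q * w₃ q - w₁ q * w₂ q * z₁ q) * e₂

theorem solves_of_mem {a b : ℝ} {q : State} (hq : q ∈ thirdSystem a b) :
    w₁ q ≠ 0 ∧ Solves a b (S q) (T q) (x₁ q) (y₁ q) (z₁ q) (w₁ q) (omega q 2) := by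
  obtain ⟨hp, hw₁, hw₂, h1, h2⟩ := hq
  obtain ⟨c1, c2⟩ := mem_phaseSpace_iff.1 hp
  have hS := S_coe q
  have hT := T_coe q
  have e₁ : y₂ q * w₁ q + x₁ q * w₂ q + z₁ q * w₃ q + 2 * S q * w₁ q = 0 := by
    rw [firstRelation] at h1
    rw [complexS] at hS
    have : (w₂ q * x₁ q + w₁ q * y₂ q + w₃ q * z₁ q) / w₁ q = -2 * S q := by
      rw [hS, show y₂ q * w₁ q + x₁ q * w₂ q + z₁ q * w₃ q =
        w₂ q * x₁ q + w₁ q * y₂ q + w₃ q * z₁ q by ring,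
        show x₂ q * w₁ q + y₁ q * w₂ q + z₂ q * w₃ q =
        w₁ q * x₂ q + w₂ q * y₁ q + w₃ q * z₂ q by ring]
      linear_combination (1 / 2) * h1
    rw [div_eq_iff hw₁] at this
    linear_combination this
  have e₂ : y₁ q * w₂ q + x₂ q * w₁ q + z₂ q * w₃ q + 2 * S q * w₂ q = 0 := by
    have := congrArg conj e₁
    simpa [x₂_eq, y₂_eq, z₂_eq, w₂_eq, w₃, map_ofNat] using this
  have e₃ : x₂ q * z₁ q - z₂ q * y₂ q - 2 * S q * z₂ q - 2 * S q * w₂ q * w₃ q = 0 := by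
    rw [secondRelation_mul_eq hw₁ hw₂ _ e₁ e₂] at h2
    simpa [hw₁] using h2
  refine ⟨hw₁, c1, c2, ?_, ?_, ?_⟩
  · rw [← y₂_eq, ← w₂_eq]; exact e₁
  · have := congrArg conj e₃
    simp only [x₂_eq, y₂_eq, z₂_eq, w₂_eq, w₃, map_sub, map_mul, conj_conj, conj_ofReal,
      map_ofNat, map_zero] at this
    linear_combination this
  · rw [hT, complexT, ← x₂_eq, ← z₂_eq, ← w₂_eq]
    linear_combination (-(1 / 2) * w₁ q) * e₂ + (-(1 / 2) * w₂ q) * e₁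

/-- The state with prescribed complex variables. -/
noncomputable def stateOf (x y z w : ℂ) (h : ℝ) : State :=
  (![(x.re + y.re) / 2, (x.im + y.im) / 2, z.re],
    ![(x.im - y.im) / 2, (y.re - x.re) / 2, z.im], ![w.re, w.im, h])

theorem stateOf_spec (x y z w : ℂ) (h : ℝ) : x₁ (stateOf x y z w h) = x ∧
    y₁ (stateOf x y z w h) = y ∧ z₁ (stateOf x y z w h) = z ∧ w₁ (stateOf x y z w h) = w ∧
    omega (stateOf x y z w h) 2 = h := by
  refine ⟨?_, ?_, ?_, ?_, rfl⟩
  · apply Complex.ext <;> simp [x₁, stateOf, fieldA, fieldB] <;> ring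
  · apply Complex.ext <;> simp [y₁, stateOf, fieldA, fieldB] <;> ring
  · apply Complex.ext <;> simp [z₁, stateOf, fieldA, fieldB]
  · apply Complex.ext <;> simp [w₁, stateOf, omega]

theorem Solves.exists_mem {a b s τ : ℝ} {x y z w : ℂ} {h : ℝ} (hs : Solves a b s τ x y z w h)
    (hw : w ≠ 0) : ∃ q ∈ thirdSystem a b, integralMap q = (s, τ) := by
  obtain ⟨q, rfl, rfl, rfl, rfl, rfl⟩ : ∃ q : State, x₁ q = x ∧ y₁ q = y ∧ z₁ q = z ∧ w₁ q = w ∧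
    omega q 2 = h := ⟨_, stateOf_spec x y z w h⟩
  have hw₂ : w₂ q ≠ 0 := by rw [w₂_eq]; simpa using hw
  have e₁ : y₂ q * w₁ q + x₁ q * w₂ q + z₁ q * w₃ q + 2 * s * w₁ q = 0 := by
    rw [y₂_eq, w₂_eq]; exact hs.first
  have e₂ : y₁ q * w₂ q + x₂ q * w₁ q + z₂ q * w₃ q + 2 * s * w₂ q = 0 := by
    have := congrArg conj e₁
    simpa [x₂_eq, y₂_eq, z₂_eq, w₂_eq, w₃, map_ofNat] using this
  have e₃ : x₂ q * z₁ q - z₂ q * y₂ q - 2 * s * z₂ q - 2 * s * w₂ q * w₃ q = 0 := by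
    have := congrArg conj hs.second
    simp only [map_sub, map_mul, conj_conj, conj_ofReal, map_ofNat] at this
    rw [x₂_eq, y₂_eq, z₂_eq, w₂_eq, w₃]
    linear_combination this
  have hA : (y₂ q * w₁ q + x₁ q * w₂ q + z₁ q * w₃ q) / w₁ q = -2 * s := by
    rw [div_eq_iff hw]; linear_combination e₁
  have hB : (x₂ q * w₁ q + y₁ q * w₂ q + z₂ q * w₃ q) / w₂ q = -2 * s := by
    rw [div_eq_iff hw₂]; linear_combination e₂
  refine ⟨q, ⟨mem_phaseSpace_iff.2 ⟨hs.square, hs.norm⟩, hw, hw₂, ?_, ?_⟩, ?_⟩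
  · rw [firstRelation, show w₂ q * x₁ q + w₁ q * y₂ q + w₃ q * z₁ q =
      y₂ q * w₁ q + x₁ q * w₂ q + z₁ q * w₃ q by ring, show w₁ q * x₂ q + w₂ q * y₁ q + w₃ q * z₂ q =
      x₂ q * w₁ q + y₁ q * w₂ q + z₂ q * w₃ q by ring, hA, hB, sub_self]
  · rw [secondRelation_mul_eq hw hw₂ _ e₁ e₂, e₃, mul_zero]
  · have hS : S q = s := by
      have : ((S q : ℝ) : ℂ) = s := by
        rw [S_coe, complexS, hA, hB]; ring
      exact_mod_cast this
    have hT : T q = τ := by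
      have : ((T q : ℝ) : ℂ) = τ := by
        have hv := hs.value
        rw [← x₂_eq, ← z₂_eq, ← w₂_eq] at hv
        rw [T_coe, complexT, ← hv]
        linear_combination ((1 / 2) * w₁ q) * e₂ + ((1 / 2) * w₂ q) * e₁
      exact_mod_cast this
    rw [integralMap, hS, hT]

/-! ### Elimination of the angular velocity. -/

section Algebra

variable {a b s τ h : ℝ} {x y z w : ℂ}

theorem ofReal_normSq_eq (u : ℂ) : (normSq u : ℂ) = u * conj u := (mul_conj u).symm

/-- Eliminating `w̄` between `first` and its conjugate gives `w (|y + 2s|² - |x|²) = h (x z̄ - (y +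
2s) z)`. By `second` the right side is `2s h² w`, and `w` cancels. -/
theorem Solves.normSq_add (H : Solves a b s τ x y z w h) (hw : w ≠ 0) :
    normSq (y + 2 * s) = normSq x + 2 * s * h ^ 2 := by
  have e1 := H.first
  have e2 := congrArg conj e1
  have e3 := H.second
  simp only [map_add, map_mul, conj_conj, conj_ofReal, map_ofNat, map_zero] at e2
  have : w * ((normSq (y + 2 * s) : ℂ) - (normSq x + 2 * s * h ^ 2)) = 0 := by
    simp only [ofReal_normSq_eq, map_add, map_mul, conj_ofReal, map_ofNat]
    linear_combination -x * e2 + (y + 2 * s) * e1 + h * e3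
  have := (mul_eq_zero.1 this).resolve_left hw
  exact_mod_cast sub_eq_zero.1 this

/-- The polynomial identity relating the two forms of the elimination of the angular velocity. -/
theorem elimination_identity (s τ : ℝ)
    (c₁ : x * conj y + z ^ 2 = ((a ^ 2 - b ^ 2 : ℝ) : ℂ))
    (c₂ : x * conj x + y * conj y + 2 * (z * conj z) = ((2 * (a ^ 2 + b ^ 2) : ℝ) : ℂ)) :
    (normSq x + normSq z - τ) * (normSq (y + 2 * s) - normSq x) -
        normSq (x * conj z - (y + 2 * s) * z) =
      discr a b 0 τ + 4 * s ^ 2 * (normSq x - τ) + 4 * s * ((a ^ 2 - b ^ 2) * x.re - τ * y.re) -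
        (normSq x + normSq z - τ) ^ 2 := by
  have c₁' := congrArg conj c₁
  simp only [map_add, map_mul, map_pow, conj_conj, conj_ofReal] at c₁'
  apply ofReal_injective
  have hx : ((x.re : ℝ) : ℂ) = (x + conj x) / 2 := re_eq_add_conj x
  have hy : ((y.re : ℝ) : ℂ) = (y + conj y) / 2 := re_eq_add_conj y
  push_cast at c₁ c₂ c₁'
  unfold discr
  push_cast
  simp only [ofReal_normSq_eq, hx, hy, map_add, map_sub, map_mul, conj_conj, conj_ofReal, map_ofNat]
  linear_combination -(τ : ℂ) * c₂ + ((a : ℂ) ^ 2 - b ^ 2) * c₁' +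
    (conj x * y + conj z ^ 2) * c₁ + 2 * s * (x * c₁' + conj x * c₁)

theorem normSq_combination (τ : ℝ)
    (c₁ : x * conj y + z ^ 2 = ((a ^ 2 - b ^ 2 : ℝ) : ℂ))
    (c₂ : x * conj x + y * conj y + 2 * (z * conj z) = ((2 * (a ^ 2 + b ^ 2) : ℝ) : ℂ)) :
    normSq (((a ^ 2 - b ^ 2 : ℝ) : ℂ) * x - τ * y) =
      discr a b 0 τ * (normSq x - τ) + τ * (normSq x + normSq z - τ) ^ 2 := by
  have c₁' := congrArg conj c₁
  simp only [map_add, map_mul, map_pow, conj_conj, conj_ofReal] at c₁'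
  apply ofReal_injective
  push_cast at c₁ c₂ c₁'
  unfold discr
  push_cast
  simp only [ofReal_normSq_eq, map_sub, map_mul, map_pow, conj_ofReal]
  linear_combination (τ : ℂ) ^ 2 * c₂ + τ * (-(x * conj x) * c₂ +
    (conj x * y - ((a : ℂ) ^ 2 - b ^ 2)) * c₁ - z ^ 2 * c₁')

theorem inTriangle_iff_sq_le (hb : 0 < b) (hab : b < a) {ξ U : ℝ} (hξ : 0 ≤ ξ) :
    InTriangle a b ξ U ↔ (U - (a ^ 2 - b ^ 2)) ^ 2 ≤ (2 * b * ξ) ^ 2 ∧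
      (2 * a * ξ) ^ 2 ≤ (U + (a ^ 2 - b ^ 2)) ^ 2 := by
  have ha : 0 < a := hb.trans hab
  have hr0 : 0 < a ^ 2 - b ^ 2 := by nlinarith
  constructor
  · rintro ⟨h1, h2, h3⟩
    exact ⟨sq_le_sq' (by linarith) h1, by gcongr⟩
  · rintro ⟨h1, h2⟩
    have k1 := abs_le.1 (abs_le_of_sq_le_sq h1 (by positivity))
    refine ⟨k1.2, by linarith, ?_⟩
    have hU : 0 ≤ U := by
      have : ξ ^ 2 * b ^ 2 ≤ ξ ^ 2 * a ^ 2 := by gcongr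
      nlinarith
    exact (sq_le_sq₀ (by positivity) (by positivity)).1 h2

theorem normSq_constraint
    (c₂ : x * conj x + y * conj y + 2 * (z * conj z) = ((2 * (a ^ 2 + b ^ 2) : ℝ) : ℂ)) :
    normSq x + normSq y + 2 * normSq z = 2 * (a ^ 2 + b ^ 2) := by
  apply ofReal_injective
  rw [← c₂]
  push_cast
  simp only [ofReal_normSq_eq]

/-- The constraints determine `Re z²` from `|x|` and `U` through `|x|² |y|² = |r² - z²|²`. The
triangle expresses `-|z|² ≤ Re z² ≤ |z|²`. -/
theorem inTriangle_of_constraints (hb : 0 < b) (hab : b < a)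
    (c₁ : x * conj y + z ^ 2 = ((a ^ 2 - b ^ 2 : ℝ) : ℂ))
    (c₂ : x * conj x + y * conj y + 2 * (z * conj z) = ((2 * (a ^ 2 + b ^ 2) : ℝ) : ℂ)) :
    InTriangle a b ‖x‖ (normSq x + normSq z) := by
  rw [inTriangle_iff_sq_le hb hab (norm_nonneg x)]
  have hr0 : 0 < a ^ 2 - b ^ 2 := by nlinarith
  have n₂ := normSq_constraint c₂
  have n₁ : normSq x * normSq y = (a ^ 2 - b ^ 2) ^ 2 -
      2 * (a ^ 2 - b ^ 2) * (z.re ^ 2 - z.im ^ 2) + normSq z ^ 2 := by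
    rw [← normSq_conj y, ← normSq_mul, eq_sub_of_add_eq c₁]
    simp [normSq_apply, pow_two]
    ring
  have hx : ‖x‖ ^ 2 = normSq x := (normSq_eq_norm_sq x).symm
  have hz : normSq z = z.re ^ 2 + z.im ^ 2 := by rw [normSq_apply]; ring
  rw [mul_pow, mul_pow, hx]
  have i1 := mul_nonneg hr0.le (sq_nonneg z.re)
  have i2 := mul_nonneg hr0.le (sq_nonneg z.im)
  have hy : normSq y = 2 * (a ^ 2 + b ^ 2) - normSq x - 2 * normSq z := by linarith
  rw [hy] at n₁
  constructor <;> nlinarith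

/-- Here `U = a² + b²` and `zU = z̄ r²`. Comparing moduli forces `z = 0`, since `(a² + b²)² ≠ (a² -
b²)²`; then `|x|²` would equal both `a² + b²` and `a² - b²`. This is what excludes `s = 0`, on the
subsystem and in its limits. -/
theorem not_degenerate_of_constraints (hb : 0 < b) (hab : b < a)
    (c₁ : x * conj y + z ^ 2 = ((a ^ 2 - b ^ 2 : ℝ) : ℂ))
    (c₂ : x * conj x + y * conj y + 2 * (z * conj z) = ((2 * (a ^ 2 + b ^ 2) : ℝ) : ℂ))
    (h₁ : normSq y = normSq x) (h₂ : x * conj z = y * z) : False := by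
  have n₂ := normSq_constraint c₂
  have k : z * (normSq x + normSq z : ℝ) = conj z * (a ^ 2 - b ^ 2 : ℝ) := by
    have h₁' : (normSq y : ℂ) = normSq x := by rw [h₁]
    rw [← c₁]
    push_cast
    rw [← h₁']
    simp only [ofReal_normSq_eq]
    linear_combination -conj y * h₂
  have hU : normSq x + normSq z = a ^ 2 + b ^ 2 := by linarith
  rw [hU] at k
  have hr0 : 0 < a ^ 2 - b ^ 2 := by nlinarith
  have k' := congrArg normSq k
  simp only [normSq_mul, normSq_conj, normSq_ofReal] at k'
  have hz : normSq z = 0 := by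
    have : normSq z * (4 * (a ^ 2 * b ^ 2)) = 0 := by linarith
    exact (mul_eq_zero.1 this).resolve_right (by have := hb.trans hab; positivity)
  have hz0 : z = 0 := normSq_eq_zero.1 hz
  have c := congrArg normSq c₁
  rw [hz0] at c
  simp only [ne_eq, OfNat.ofNat_ne_zero, not_false_eq_true, zero_pow, add_zero, normSq_mul,
    normSq_conj, normSq_ofReal, h₁] at c
  have hx : normSq x = a ^ 2 + b ^ 2 := by linarith
  rw [hx] at c
  have : 0 < a ^ 2 * b ^ 2 := by have := hb.trans hab; positivity
  nlinarith

theorem Solves.normSq_value (H : Solves a b s τ x y z w h) :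
    normSq x + normSq z - τ = 2 * s * normSq w := by
  apply ofReal_injective
  push_cast
  simp only [ofReal_normSq_eq]
  linear_combination H.value

theorem Solves.ne_zero (hb : 0 < b) (hab : b < a) (H : Solves a b s τ x y z w h) (hw : w ≠ 0) :
    s ≠ 0 := by
  rintro rfl
  have h1 := H.normSq_add hw
  have h2 := H.second
  simp only [ofReal_zero, mul_zero, add_zero, zero_mul, sub_zero] at h1 h2
  exact not_degenerate_of_constraints hb hab H.square H.norm h1 (sub_eq_zero.1 h2)

theorem Solves.attainedAt (hb : 0 < b) (hab : b < a) (H : Solves a b s τ x y z w h)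
    (hw : w ≠ 0) : AttainedAt a b s τ ‖x‖ (normSq x + normSq z) := by
  have hs := H.ne_zero hb hab hw
  have hv := H.normSq_value
  have hn : 0 < normSq w := normSq_pos.2 hw
  have hx : ‖x‖ ^ 2 = normSq x := (normSq_eq_norm_sq x).symm
  have hE : 0 < s * (normSq x + normSq z - τ) := by
    rw [hv]
    have := mul_pos (pow_pos (abs_pos.2 hs) 2) hn
    rw [sq_abs] at this
    linarith
  have hJ := elimination_identity s τ H.square H.norm
  have hM : normSq (x * conj z - (y + 2 * s) * z) = 4 * s ^ 2 * h ^ 2 * normSq w := by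
    rw [show x * conj z - (y + 2 * s) * z = ((2 * s * h : ℝ) : ℂ) * w by
      push_cast; linear_combination H.second, normSq_mul, normSq_ofReal]
    ring
  rw [hM, H.normSq_add hw, hv] at hJ
  have hR := normSq_combination τ H.square H.norm
  have hQ : ((a ^ 2 - b ^ 2) * x.re - τ * y.re) ^ 2 ≤
      normSq (((a ^ 2 - b ^ 2 : ℝ) : ℂ) * x - τ * y) := by
    have := re_sq_le_normSq (((a ^ 2 - b ^ 2 : ℝ) : ℂ) * x - τ * y)
    rw [sub_re, re_ofReal_mul, re_ofReal_mul] at this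
    linarith
  rw [hR] at hQ
  rw [hv] at hQ
  have hD : discr a b s τ = discr a b 0 τ + 4 * s ^ 2 * τ := by unfold discr; ring
  -- This is `16s² (Q² - |r² x - τ y|²) ≤ 0`, rewritten with the value of `Q` given by `hJ`.
  have hprod : ((normSq x + normSq z - τ - 2 * s * ‖x‖) ^ 2 - discr a b s τ) *
      ((normSq x + normSq z - τ + 2 * s * ‖x‖) ^ 2 - discr a b s τ) ≤ 0 := by
    rw [hv, hD]
    have key := mul_le_mul_of_nonneg_left hQ (by positivity : 0 ≤ 16 * s ^ 2)
    have e : 4 * s * ((a ^ 2 - b ^ 2) * x.re - τ * y.re) = (2 * s * normSq w) ^ 2 -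
        discr a b 0 τ - 4 * s ^ 2 * (‖x‖ ^ 2 - τ) := by rw [hx]; linarith
    rw [← hx] at key
    have e2 := congrArg (· ^ 2) e
    simp only [mul_pow _ _ 2] at e2
    generalize discr a b 0 τ = d at *
    nlinarith
  have hd : 0 ≤ s * (normSq x + normSq z - τ) * ‖x‖ := mul_nonneg hE.le (norm_nonneg x)
  refine ⟨inTriangle_of_constraints hb hab H.square H.norm, hE, ?_, ?_⟩
  · by_contra! hc
    have := mul_pos (sub_pos.2 hc) (by linarith :
      0 < (normSq x + normSq z - τ + 2 * s * ‖x‖) ^ 2 - discr a b s τ)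
    linarith
  · by_contra! hc
    have := mul_pos_of_neg_of_neg (sub_neg.2 hc) (by linarith :
      (normSq x + normSq z - τ - 2 * s * ‖x‖) ^ 2 - discr a b s τ < 0)
    linarith

/-! ### Reconstruction of a point of the subsystem. -/

theorem exists_unit_re_mul_eq {K : ℂ} {Q : ℝ} (hQ : Q ^ 2 ≤ normSq K) :
    ∃ u : ℂ, u * conj u = 1 ∧ (u * K).re = Q := by
  rcases eq_or_ne K 0 with rfl | hK
  · refine ⟨1, by simp, ?_⟩
    rw [normSq_zero] at hQ
    simp [pow_eq_zero_iff two_ne_zero |>.1 (le_antisymm hQ (sq_nonneg Q))]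
  · have hn : 0 < normSq K := normSq_pos.2 hK
    -- `v` has real part `Q` and the modulus of `K`, so `v / K` is the required rotation.
    set v : ℂ := Q + √(normSq K - Q ^ 2) * I with hv
    have hvn : v * conj v = normSq K := by
      rw [mul_conj, normSq_apply]
      simp only [hv, add_re, ofReal_re, mul_re, I_re, mul_zero, ofReal_im, I_im, mul_one, sub_self,
        add_zero, add_im, mul_im, zero_add]
      rw [Real.mul_self_sqrt (by linarith)]
      congr 1
      ring
    refine ⟨v / K, ?_, ?_⟩
    · rw [map_div₀, div_mul_div_comm, hvn, mul_conj, div_self]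
      exact_mod_cast hn.ne'
    · rw [div_mul_cancel₀ _ hK]
      simp [hv]

/-- Points of the phase space over a point of the triangle, with a given value of a real linear
form in `x₁`, `y₁`. -/
theorem exists_constraints (hb : 0 < b) (hab : b < a) {ξ U Q : ℝ} (hξ : 0 < ξ)
    (ht : InTriangle a b ξ U)
    (hQ : Q ^ 2 ≤ discr a b 0 τ * (ξ ^ 2 - τ) + τ * (U - τ) ^ 2) :
    ∃ x y z : ℂ, x * conj y + z ^ 2 = ((a ^ 2 - b ^ 2 : ℝ) : ℂ) ∧
      x * conj x + y * conj y + 2 * (z * conj z) = ((2 * (a ^ 2 + b ^ 2) : ℝ) : ℂ) ∧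
      normSq x = ξ ^ 2 ∧ normSq x + normSq z = U ∧
      (a ^ 2 - b ^ 2) * x.re - τ * y.re = Q := by
  have hr0 : 0 < a ^ 2 - b ^ 2 := by nlinarith
  obtain ⟨t1, t2⟩ := (inTriangle_iff_sq_le hb hab hξ.le).1 ht
  -- `Y` and `c` are the values of `|y|²` and `Re z²` forced by the constraints; the triangle
  -- inequalities give `|c| ≤ U - ξ²`, so that `z` exists.
  set Y : ℝ := 2 * (a ^ 2 + b ^ 2) - ξ ^ 2 - 2 * (U - ξ ^ 2) with hY
  set c : ℝ := ((a ^ 2 - b ^ 2) ^ 2 + (U - ξ ^ 2) ^ 2 - ξ ^ 2 * Y) / (2 * (a ^ 2 - b ^ 2)) with hc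
  have hc' : c * (2 * (a ^ 2 - b ^ 2)) = (a ^ 2 - b ^ 2) ^ 2 + (U - ξ ^ 2) ^ 2 - ξ ^ 2 * Y :=
    div_mul_cancel₀ _ (by positivity)
  have hc1 : 0 ≤ (U - ξ ^ 2 + c) / 2 := by
    have : 0 ≤ (U - ξ ^ 2 + c) * (2 * (a ^ 2 - b ^ 2)) := by rw [add_mul, hc', hY]; linarith
    have := nonneg_of_mul_nonneg_left this (by positivity)
    positivity
  have hc2 : 0 ≤ (U - ξ ^ 2 - c) / 2 := by
    have : 0 ≤ (U - ξ ^ 2 - c) * (2 * (a ^ 2 - b ^ 2)) := by rw [sub_mul, hc', hY]; linarith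
    have := nonneg_of_mul_nonneg_left this (by positivity)
    positivity
  obtain ⟨z, hz1, hz2⟩ : ∃ z : ℂ, normSq z = U - ξ ^ 2 ∧ z.re ^ 2 - z.im ^ 2 = c := by
    refine ⟨⟨√((U - ξ ^ 2 + c) / 2), √((U - ξ ^ 2 - c) / 2)⟩, ?_, ?_⟩
    · rw [normSq_mk, Real.mul_self_sqrt hc1, Real.mul_self_sqrt hc2]; ring
    · simp only [Real.sq_sqrt hc1, Real.sq_sqrt hc2]; ring
  have hξ' : (ξ : ℂ) ≠ 0 := by exact_mod_cast hξ.ne'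
  -- With `x = ξ` real, this is the only `y` allowed by the constraint `x ȳ + z² = r²`. The rotation
  -- `u` then adjusts the linear form to `Q`.
  set κ : ℂ := (((a ^ 2 - b ^ 2 : ℝ) : ℂ) - conj z ^ 2) / ξ with hκ
  have k1 : (ξ : ℂ) * conj κ + z ^ 2 = ((a ^ 2 - b ^ 2 : ℝ) : ℂ) := by
    rw [hκ, map_div₀, map_sub, map_pow, conj_conj, conj_ofReal, conj_ofReal]
    field_simp
    ring
  have k2 : normSq κ = Y := by
    have : normSq κ * ξ ^ 2 = ξ ^ 2 * Y := by
      rw [hκ, normSq_div, normSq_ofReal, ← pow_two, div_mul_cancel₀ _ (by positivity)]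
      have : normSq (((a ^ 2 - b ^ 2 : ℝ) : ℂ) - conj z ^ 2) = (a ^ 2 - b ^ 2) ^ 2 -
          2 * (a ^ 2 - b ^ 2) * (z.re ^ 2 - z.im ^ 2) + normSq z ^ 2 := by
        rw [normSq_apply, normSq_apply]
        simp only [pow_two, sub_re, sub_im, mul_re, mul_im, conj_re, conj_im, ofReal_re, ofReal_im]
        ring
      rw [this, hz1, hz2]
      linarith
    exact mul_right_cancel₀ (by positivity) (this.trans (mul_comm _ _))
  have k3 : (ξ : ℂ) * conj (ξ : ℂ) + κ * conj κ + 2 * (z * conj z) =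
      ((2 * (a ^ 2 + b ^ 2) : ℝ) : ℂ) := by
    rw [mul_conj, mul_conj, mul_conj, k2, hz1, hY, normSq_ofReal]
    push_cast
    ring
  have hK := normSq_combination τ k1 k3
  rw [normSq_ofReal, hz1, ← pow_two, add_sub_cancel] at hK
  obtain ⟨u, hu, hu'⟩ := exists_unit_re_mul_eq (hQ.trans hK.ge)
  refine ⟨u * ξ, u * κ, z, ?_, ?_, ?_, ?_, ?_⟩
  · rw [map_mul]
    linear_combination k1 + ξ * conj κ * hu
  · rw [map_mul, map_mul]
    linear_combination k3 + (ξ * conj (ξ : ℂ) + κ * conj κ) * hu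
  · have : normSq u = 1 := by
      apply ofReal_injective; rw [ofReal_normSq_eq, hu, ofReal_one]
    rw [normSq_mul, this, normSq_ofReal]; ring
  · have : normSq u = 1 := by
      apply ofReal_injective; rw [ofReal_normSq_eq, hu, ofReal_one]
    rw [normSq_mul, this, normSq_ofReal, hz1]; ring
  · rw [← hu', ← re_ofReal_mul, ← re_ofReal_mul, ← sub_re]
    congr 1
    ring

/-- Here `k` is the future `h²`. For `k > 0` the second equation defines `w`, and the first follows
from `h₁`. For `k = 0` the second equation loses `w`; then `|y + 2s| = |x|`, and every `x v̄ - (y +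
2s) v` solves the real-linear first equation. Since `x ≠ 0`, some such value is nonzero, and it is
rescaled to the prescribed norm. -/
theorem exists_angular_velocity {n k : ℝ} (hs : s ≠ 0) (hn : 0 < n) (hx : x ≠ 0)
    (h₁ : normSq (y + 2 * s) = normSq x + 2 * s * k)
    (h₂ : normSq (x * conj z - (y + 2 * s) * z) = 4 * s ^ 2 * k * n) :
    ∃ (w : ℂ) (h : ℝ), w ≠ 0 ∧ normSq w = n ∧
      conj y * w + x * conj w + z * h + 2 * s * w = 0 ∧
      x * conj z - y * z - 2 * s * z = 2 * s * w * h := by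
  have hs' : (s : ℂ) ≠ 0 := by exact_mod_cast hs
  have h₁' : (y + 2 * s) * (conj y + 2 * s) = x * conj x + 2 * s * k := by
    have := congrArg (fun r : ℝ => (r : ℂ)) h₁
    push_cast at this
    simpa [ofReal_normSq_eq, map_ofNat] using this
  have hk : 0 ≤ k := by
    have h3 : 0 ≤ k * (4 * s ^ 2 * n) := by
      have := normSq_nonneg (x * conj z - (y + 2 * s) * z)
      rw [h₂] at this; linarith
    exact nonneg_of_mul_nonneg_left h3 (by positivity)
  rcases hk.eq_or_lt with rfl | hk
  · have hM : x * conj z - (y + 2 * s) * z = 0 := by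
      rw [← normSq_eq_zero, h₂]; ring
    obtain ⟨v, hv⟩ : ∃ v : ℂ, x * conj v - (y + 2 * s) * v ≠ 0 := by
      by_contra! hc
      have e1 := hc 1
      have e2 := hc I
      simp only [map_one, mul_one, conj_I] at e1 e2
      refine hx ?_
      have e3 : I * (2 * x) = 0 := by linear_combination I * e1 - e2
      simpa using e3
    set m : ℂ := x * conj v - (y + 2 * s) * v with hm
    have hmn : 0 < normSq m := normSq_pos.2 hv
    have hkey : x * conj m + (conj y + 2 * s) * m = 0 := by
      simp only [hm, map_sub, map_mul, map_add, conj_conj, conj_ofReal, map_ofNat]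
      simp only [ofReal_zero, mul_zero, add_zero] at h₁'
      linear_combination -v * h₁'
    refine ⟨(√(n / normSq m) : ℝ) * m, 0, ?_, ?_, ?_, ?_⟩
    · refine mul_ne_zero ?_ hv
      exact_mod_cast (Real.sqrt_pos.2 (by positivity)).ne'
    · rw [normSq_mul, normSq_ofReal, Real.mul_self_sqrt (by positivity), div_mul_cancel₀ _ hmn.ne']
    · rw [map_mul, conj_ofReal, ofReal_zero]
      linear_combination (√(n / normSq m) : ℂ) * hkey
    · rw [ofReal_zero]; linear_combination hM
  · have hh : √k ^ 2 = k := Real.sq_sqrt hk.le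
    have hh' : (√k : ℂ) ^ 2 = k := by exact_mod_cast hh
    have hh0 : (√k : ℂ) ≠ 0 := by exact_mod_cast (Real.sqrt_pos.2 hk).ne'
    have hne : x * conj z - (y + 2 * s) * z ≠ 0 := by
      rw [← normSq_pos, h₂]; positivity
    refine ⟨(x * conj z - (y + 2 * s) * z) / ((2 * s * √k : ℝ) : ℂ), √k, ?_, ?_, ?_, ?_⟩
    · refine div_ne_zero hne ?_
      push_cast
      exact mul_ne_zero (mul_ne_zero two_ne_zero hs') hh0
    · rw [normSq_div, h₂, normSq_ofReal]
      have : 2 * s * √k * (2 * s * √k) = 4 * s ^ 2 * k := by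
        linear_combination 4 * s ^ 2 * hh
      rw [this]
      field_simp
    · rw [map_div₀, conj_ofReal]
      simp only [map_sub, map_mul, map_add, conj_conj, conj_ofReal, map_ofNat]
      push_cast
      field_simp
      linear_combination -z * h₁' + 2 * s * z * hh'
    · push_cast
      field_simp
      ring

theorem AttainedAt.exists_mem (hb : 0 < b) (hab : b < a) {ξ U : ℝ} (hξ : 0 < ξ)
    (H : AttainedAt a b s τ ξ U) : ∃ q ∈ thirdSystem a b, integralMap q = (s, τ) := by
  obtain ⟨ht, hE, hf, hg⟩ := H
  have hs : s ≠ 0 := by rintro rfl; simp at hE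
  -- The value of the linear form at which `elimination_identity` makes the eliminated equation
  -- hold.
  set Q : ℝ := ((U - τ) ^ 2 - discr a b 0 τ - 4 * s ^ 2 * (ξ ^ 2 - τ)) / (4 * s) with hQ
  have hQ' : 4 * s * Q = (U - τ) ^ 2 - discr a b 0 τ - 4 * s ^ 2 * (ξ ^ 2 - τ) :=
    mul_div_cancel₀ _ (by positivity)
  have hD : discr a b s τ = discr a b 0 τ + 4 * s ^ 2 * τ := by unfold discr; ring
  have hQle : Q ^ 2 ≤ discr a b 0 τ * (ξ ^ 2 - τ) + τ * (U - τ) ^ 2 := by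
    have h1 : (4 * s * Q) ^ 2 ≤
        16 * s ^ 2 * (discr a b 0 τ * (ξ ^ 2 - τ) + τ * (U - τ) ^ 2) := by
      have := mul_nonneg (sub_nonneg.2 hf) (sub_nonneg.2 hg)
      rw [hD] at this
      rw [hQ']
      linarith
    refine le_of_mul_le_mul_left ?_ (by positivity : 0 < 16 * s ^ 2)
    linarith
  obtain ⟨x, y, z, c₁, c₂, hx, hU, hre⟩ := exists_constraints hb hab hξ ht hQle
  have hJ := elimination_identity s τ c₁ c₂
  rw [hU, hre, hQ', hx] at hJ
  have hE' : 0 < (U - τ) / (2 * s) := by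
    rw [show (U - τ) / (2 * s) = s * (U - τ) / (2 * s ^ 2) by field_simp]
    positivity
  have hx0 : x ≠ 0 := by
    rw [← normSq_pos, hx]; positivity
  obtain ⟨w, h, hw, hwn, e1, e2⟩ := exists_angular_velocity
    (y := y) (z := z) (k := (normSq (y + 2 * s) - normSq x) / (2 * s)) hs hE' hx0
    (by field_simp; ring)
    (by
      have : 4 * s ^ 2 * ((normSq (y + 2 * s) - normSq x) / (2 * s)) * ((U - τ) / (2 * s)) =
        (U - τ) * (normSq (y + 2 * s) - normSq x) := by field_simp; ring
      rw [this, hx]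
      linarith)
  refine Solves.exists_mem (x := x) (y := y) (z := z) (w := w) (h := h)
    ⟨c₁, c₂, e1, e2, ?_⟩ hw
  rw [mul_conj, mul_conj, mul_conj, hwn]
  have : normSq x + normSq z - 2 * s * ((U - τ) / (2 * s)) = τ := by
    rw [hU]; field_simp; ring
  exact_mod_cast this

end Algebra

/-! ### The image and its limit points. -/

open Filter Topology

variable {a b s τ : ℝ}

theorem mem_image_integralMap_iff (hb : 0 < b) (hab : b < a) :
    (s, τ) ∈ integralMap '' thirdSystem a b ↔ s ≠ 0 ∧ Admissible a b s τ ∧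
      (0 < s → τ < (a + b) ^ 2) ∧ (s < 0 → (a - b) ^ 2 < τ) := by
  constructor
  · rintro ⟨q, hq, h⟩
    obtain ⟨hw, H⟩ := solves_of_mem hq
    obtain ⟨rfl, rfl⟩ := Prod.mk.inj h
    have hA := H.attainedAt hb hab hw
    exact ⟨H.ne_zero hb hab hw, hA.admissible hb hab, hA.lt_of_pos hb hab, hA.lt_of_neg hb hab⟩
  · rintro ⟨hs, hA, h₁, h₂⟩
    obtain ⟨x, U, hx, h⟩ := hA.exists_attainedAt hb hab hs h₁ h₂
    exact h.exists_mem hb hab hx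

theorem isClosed_setOf_or {X : Type*} [TopologicalSpace X] {p q : X → Prop}
    (hp : IsClosed {x | p x}) (hq : IsClosed {x | q x}) : IsClosed {x | p x ∨ q x} :=
  hp.union hq

theorem isClosed_admissible (a b : ℝ) : IsClosed {f : ℝ × ℝ | Admissible a b f.1 f.2} := by
  have hD : Continuous fun f : ℝ × ℝ => discr a b f.1 f.2 := by unfold discr; fun_prop
  simp only [Admissible]
  refine isClosed_setOf_or (.and ?_ (.and ?_ (.and ?_ (.and (isClosed_setOf_or ?_ ?_) (isClosed_setOf_or ?_ ?_)))))
    (.and ?_ (.and ?_ (.and ?_ (.and ?_ (isClosed_setOf_or ?_ ?_))))) <;>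
  exact isClosed_le (by fun_prop) (by fun_prop)

theorem continuous_x₁ : Continuous x₁ := by unfold x₁ fieldA fieldB; fun_prop

theorem continuous_y₁ : Continuous y₁ := by unfold y₁ fieldA fieldB; fun_prop

theorem continuous_z₁ : Continuous z₁ := by unfold z₁ fieldA fieldB; fun_prop

theorem continuous_w₁ : Continuous w₁ := by unfold w₁ omega; fun_prop

theorem extendedImage_subset (hb : 0 < b) (hab : b < a) :
    extendedImage a b ⊆ {f | f.1 ≠ 0 ∧ Admissible a b f.1 f.2} := by
  rintro _ ⟨⟨q, f⟩, hq, rfl⟩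
  have hx := continuous_x₁
  have hy := continuous_y₁
  have hz := continuous_z₁
  have hw := continuous_w₁
  have hconj := continuous_conj
  -- `w` may tend to `0`, where `first` becomes vacuous if `h` also vanishes. Hence `G` uses its
  -- consequence with `w` already cancelled: a closed condition that still carries information in
  -- the limit.
  let G : Set (State × ℝ × ℝ) := {p |
    x₁ p.1 * conj (y₁ p.1) + z₁ p.1 ^ 2 = ((a ^ 2 - b ^ 2 : ℝ) : ℂ) ∧
    x₁ p.1 * conj (x₁ p.1) + y₁ p.1 * conj (y₁ p.1) + 2 * (z₁ p.1 * conj (z₁ p.1)) =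
      ((2 * (a ^ 2 + b ^ 2) : ℝ) : ℂ) ∧
    normSq (y₁ p.1 + 2 * p.2.1) = normSq (x₁ p.1) + 2 * p.2.1 * omega p.1 2 ^ 2 ∧
    x₁ p.1 * conj (z₁ p.1) - y₁ p.1 * z₁ p.1 - 2 * p.2.1 * z₁ p.1 =
      2 * p.2.1 * w₁ p.1 * omega p.1 2 ∧
    Admissible a b p.2.1 p.2.2}
  have hG : IsClosed G := by
    have ho : Continuous fun q : State => omega q 2 := by unfold omega; fun_prop
    refine .and ?_ (.and ?_ (.and ?_ (.and ?_ ((isClosed_admissible a b).preimage continuous_snd))))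
    · exact isClosed_eq (by fun_prop) (by fun_prop)
    · exact isClosed_eq (by fun_prop) (by fun_prop)
    · exact isClosed_eq (continuous_normSq.comp (by fun_prop))
        ((continuous_normSq.comp (by fun_prop)).add (by fun_prop))
    · exact isClosed_eq (by fun_prop) (by fun_prop)
  have hsub : (fun q : State => (q, integralMap q)) '' thirdSystem a b ⊆ G := by
    rintro _ ⟨q, hq, rfl⟩
    obtain ⟨hw, H⟩ := solves_of_mem hq
    exact ⟨H.square, H.norm, H.normSq_add hw, H.second, (H.attainedAt hb hab hw).admissible hb hab⟩
  obtain ⟨h1, h2, h3, h4, h5⟩ := closure_minimal hsub hG hq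
  refine ⟨fun h0 => ?_, h5⟩
  simp only at h0 h3 h4
  simp only [h0, ofReal_zero, mul_zero, add_zero, zero_mul, sub_zero] at h3 h4
  exact not_degenerate_of_constraints hb hab h1 h2 h3 (sub_eq_zero.1 h4)

theorem Solves.normSq_le {h : ℝ} {x y z w : ℂ} (hb : 0 < b) (hab : b < a)
    (H : Solves a b s τ x y z w h) (hw : w ≠ 0) :
    normSq w ≤ ((a + b) ^ 2 + |τ|) / |s| ∧ h ^ 2 ≤ (4 * (a ^ 2 + b ^ 2) + 8 * s ^ 2) / |s| := by
  have hs : 0 < |s| := abs_pos.2 (H.ne_zero hb hab hw)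
  have hU := (inTriangle_of_constraints hb hab H.square H.norm).le_sq hb hab
  have n₂ := normSq_constraint H.norm
  have nx := normSq_nonneg x
  have ny := normSq_nonneg y
  have nz := normSq_nonneg z
  have nw := normSq_nonneg w
  rw [le_div_iff₀ hs, le_div_iff₀ hs]
  constructor
  · have := congrArg abs H.normSq_value
    rw [abs_mul, abs_mul, abs_of_nonneg nw, abs_two] at this
    have h1 := abs_sub (normSq x + normSq z) τ
    rw [abs_of_nonneg (add_nonneg nx nz)] at h1
    have := mul_nonneg nw hs.le
    linarith
  · have h1 := H.normSq_add hw
    have h2 : normSq (y + 2 * s) ≤ 2 * (normSq y + 4 * s ^ 2) := by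
      rw [normSq_apply, normSq_apply]
      simp only [add_re, add_im, mul_re, mul_im, ofReal_re, ofReal_im, re_ofNat, im_ofNat]
      nlinarith [sq_nonneg (y.re - 2 * s)]
    have h3 : |2 * s * h ^ 2| ≤ normSq (y + 2 * s) + normSq x := by
      have n1 := normSq_nonneg (y + 2 * s)
      rw [abs_le]; constructor <;> linarith
    rw [abs_mul, abs_mul, abs_of_nonneg (sq_nonneg h), abs_two] at h3
    have := mul_nonneg (sq_nonneg h) hs.le
    linarith

theorem isBounded_phaseSpace_inter (a b C : ℝ) :
    Bornology.IsBounded {q | q ∈ phaseSpace a b ∧ normSq (w₁ q) ≤ C ∧ omega q 2 ^ 2 ≤ C} := by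
  refine (Metric.isBounded_closedBall (x := (0 : State)) (r := |a| + |b| + √C)).subset ?_
  rintro ⟨α, β, ω⟩ ⟨⟨h1, h2, -⟩, h3, h4⟩
  simp only [fieldA, fieldB, dotProduct, Fin.sum_univ_three, w₁, omega, normSq_apply, add_re,
    add_im, mul_re, mul_im, I_re, I_im, ofReal_re, ofReal_im] at h1 h2 h3 h4
  have key : ∀ {u c d : ℝ}, u ^ 2 ≤ c → √c ≤ d → ‖u‖ ≤ d := fun h h' =>
    (Real.abs_le_sqrt h).trans h'
  have ha : √(a ^ 2) ≤ |a| + |b| + √C := by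
    rw [Real.sqrt_sq_eq_abs]; linarith [abs_nonneg b, Real.sqrt_nonneg C]
  have hb : √(b ^ 2) ≤ |a| + |b| + √C := by
    rw [Real.sqrt_sq_eq_abs]; linarith [abs_nonneg a, Real.sqrt_nonneg C]
  have hC : √C ≤ |a| + |b| + √C := by linarith [abs_nonneg a, abs_nonneg b]
  have h0 : 0 ≤ |a| + |b| + √C := by positivity
  rw [mem_closedBall_zero_iff, Prod.norm_mk, Prod.norm_mk, max_le_iff, max_le_iff,
    pi_norm_le_iff_of_nonneg h0, pi_norm_le_iff_of_nonneg h0, pi_norm_le_iff_of_nonneg h0]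
  refine ⟨fun i => key (c := a ^ 2) ?_ ha, fun i => key (c := b ^ 2) ?_ hb,
    fun i => key (c := C) ?_ hC⟩ <;> fin_cases i <;> simp only [Fin.zero_eta, Fin.mk_one,
      Fin.reduceFinMk] <;> nlinarith

/-- With `s ≠ 0` fixed and `τ` bounded, `|w|² = E / (2s)` and `h²` stay bounded, so preimages of the
approximating values have a convergent subsequence. -/
theorem mem_extendedImage_of_tendsto (hb : 0 < b) (hab : b < a) {t : ℕ → ℝ}
    (ht : Tendsto t atTop (𝓝 τ)) (h : ∀ n, (s, t n) ∈ integralMap '' thirdSystem a b) :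
    (s, τ) ∈ extendedImage a b := by
  choose q hq hq' using h
  obtain ⟨B, hB⟩ := (ht.abs.bddAbove_range)
  obtain ⟨p, -, φ, hφ, hp⟩ := tendsto_subseq_of_bounded (isBounded_phaseSpace_inter a b
    (max (((a + b) ^ 2 + B) / |s|) ((4 * (a ^ 2 + b ^ 2) + 8 * s ^ 2) / |s|))) (x := q) (by
      intro n
      obtain ⟨hw, H⟩ := solves_of_mem (hq n)
      obtain ⟨hS, hT⟩ := Prod.mk.inj (hq' n)
      rw [hS, hT] at H
      obtain ⟨h1, h2⟩ := H.normSq_le hb hab hw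
      refine ⟨(hq n).1, le_max_of_le_left (h1.trans ?_), le_max_of_le_right h2⟩
      have := hB ⟨n, rfl⟩
      gcongr)
  refine ⟨(p, s, τ), ?_, rfl⟩
  refine mem_closure_of_tendsto (b := atTop) (f := fun n => (q (φ n), (s, t (φ n))))
    (hp.prodMk_nhds (tendsto_const_nhds.prodMk_nhds (ht.comp hφ.tendsto_atTop)))
    (Eventually.of_forall fun n => ⟨q (φ n), hq _, by simp only [hq']⟩)

theorem tendsto_add_div_nat (τ c : ℝ) :
    Tendsto (fun n : ℕ => τ + c * (1 / ((n : ℝ) + 1))) atTop (𝓝 τ) := by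
  simpa using (tendsto_one_div_add_atTop_nhds_zero_nat (𝕜 := ℝ)).const_mul c |>.const_add τ

theorem Admissible.mem_extendedImage (hb : 0 < b) (hab : b < a) (hs : s ≠ 0)
    (h : Admissible a b s τ) : (s, τ) ∈ extendedImage a b := by
  have hm : (a - b) ^ 2 < a ^ 2 - b ^ 2 := by nlinarith
  have hp : a ^ 2 - b ^ 2 < (a + b) ^ 2 := by nlinarith
  have hn (n : ℕ) : 0 < 1 / ((n : ℝ) + 1) ∧ 1 / ((n : ℝ) + 1) ≤ 1 := by
    refine ⟨by positivity, ?_⟩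
    rw [div_le_one (by positivity)]
    simp
  by_cases hin : (0 < s → τ < (a + b) ^ 2) ∧ (s < 0 → (a - b) ^ 2 < τ)
  · exact mem_extendedImage_of_tendsto hb hab (t := fun _ => τ) tendsto_const_nhds fun _ =>
      (mem_image_integralMap_iff hb hab).2 ⟨hs, h, hin⟩
  rcases h with ⟨k1, k2, k3, k4, k5⟩ | ⟨k1, k2, k3, k4, k5⟩
  · have hs0 : 0 < s := lt_of_le_of_ne k1 hs.symm
    have hτ : τ = (a + b) ^ 2 := by
      refine le_antisymm k2 (not_lt.1 fun h => hin ⟨fun _ => h, fun h' => ?_⟩)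
      linarith
    have hsb : b ≤ s := k5.resolve_right (by linarith)
    -- The coefficient keeps the sequence in `[r², (a + b)²)`, equal to `r²` at `n = 0`. There `τ >
    -- 0`, so `s ≥ b` alone ensures `discr ≥ 0`.
    refine mem_extendedImage_of_tendsto hb hab
      (tendsto_add_div_nat τ (-((a + b) ^ 2 - (a ^ 2 - b ^ 2)))) fun n => ?_
    obtain ⟨n1, n2⟩ := hn n
    have e1 := mul_pos (sub_pos.2 hp) n1
    have e2 := mul_le_mul_of_nonneg_left n2 (sub_pos.2 hp).le
    refine (mem_image_integralMap_iff hb hab).2 ⟨hs, .inl ⟨k1, by linarith,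
      discr_nonneg_of_le_sq (by gcongr) (by nlinarith), .inr (by nlinarith), .inl hsb⟩,
      fun _ => by linarith, fun _ => by linarith⟩
  · have hs0 : s < 0 := lt_of_le_of_ne k1 hs
    have hτ : τ = (a - b) ^ 2 := by
      refine le_antisymm (not_lt.1 fun h => hin ⟨fun h' => ?_, fun _ => h⟩) k2
      linarith
    have hsb : s ≤ -b := k5.resolve_right (by linarith)
    -- Approaching `(a - b)²` from above, any positive coefficient works, since `s ≤ -b` gives
    -- admissibility for every larger `τ`.
    refine mem_extendedImage_of_tendsto hb hab (tendsto_add_div_nat τ 1) fun n => ?_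
    obtain ⟨n1, n2⟩ := hn n
    refine (mem_image_integralMap_iff hb hab).2 ⟨hs, .inr ⟨k1, by linarith,
      discr_nonneg_of_le_sq (by nlinarith) (by nlinarith [sq_nonneg (a - b)]), k4, .inl hsb⟩,
      fun _ => by linarith, fun _ => by linarith⟩

end KowalevskiTop

theorem mainTheorem3 (a b : ℝ) (hb : 0 < b) (hab : b < a) :
    KowalevskiTop.extendedImage a b = KowalevskiTop.admissibleRegion a b ∧
    KowalevskiTop.integralMap '' KowalevskiTop.thirdSystem a b =
      KowalevskiTop.admissibleRegion a b \
        {f | (f.2 = (a - b) ^ 2 ∧ f.1 < 0) ∨ (f.2 = (a + b) ^ 2 ∧ 0 < f.1)} := by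
  constructor
  · ext ⟨s, τ⟩
    rw [KowalevskiTop.mem_admissibleRegion_iff hb hab]
    exact ⟨fun h => KowalevskiTop.extendedImage_subset hb hab h,
      fun h => h.2.mem_extendedImage hb hab h.1⟩
  · ext ⟨s, τ⟩
    rw [KowalevskiTop.mem_image_integralMap_iff hb hab, Set.mem_sdiff,
      KowalevskiTop.mem_admissibleRegion_iff hb hab, and_assoc]
    refine and_congr_right fun hs => and_congr_right fun hA => ?_
    simp only [Set.mem_ofPred_eq]
    constructor
    · rintro ⟨h1, h2⟩ (⟨h3, h4⟩ | ⟨h3, h4⟩)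
      · exact (h2 h4).ne' h3
      · exact (h1 h4).ne h3
    · intro h
      push Not at h
      rcases hA with ⟨k1, k2, -⟩ | ⟨k1, k2, -⟩
      · refine ⟨fun h0 => lt_of_le_of_ne k2 fun e => ?_, fun h0 => by linarith⟩
        linarith [h.2 e]
      · refine ⟨fun h0 => by linarith, fun h0 => lt_of_le_of_ne k2 fun e => ?_⟩
        linarith [h.1 e.symm]
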